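/- **Setting.** Let $m\in\mathbb N$ ($m\ge 1$) and $L,T>0$. Write $\lfloor y\rceil^{p}=|y|^{p}\operatorname{sign}(y)$ for $p>0$, and let $\lfloor y\rceil^{0}=\{\operatorname{sign}(y)\}$ for $y\neq0$, $\lfloor 0\rceil^{0}=[-1,1]$. Let $\mathcal F_L^{(m)}$ be the set of $m$ times differentiable functions $f:[0,\infty)\to\mathbb R$ whose $m$th derivative is Lipschitz continuous and which satisfy $|f^{(m+1)}(t)|\le L$ for almost every $t\ge0$. Let $\mathcal E_N$ be the set of real sequences $(\eta_k)$ with $|\eta_k|\le N$ for all $k$. Define $c_{i,j}$ by $c_{0,0}=1$, $c_{0,j}=c_{i,0}=0$ for $i,j\ne0$, and $c_{i,j}=\frac{(j-1)c_{i,j-1}+i\,c_{i-1,j-1}}{j}$ for $i,j\ge1$. For parameters $\lambda_1,\dots,\lambda_{m+1}>0$ and an input sequence $(u_k)$, the implicit robust exact differentiator (IRED) with initial values $z_{1,1},\dots,z_{m+1,1}\in\mathbb R$ is the system, for $k\ge1$, $$z_{i,k+1}=z_{i,k}+T\lambda_iL^{\frac{i}{m+1}}\lfloor u_k-z_{1,k+1}\rceil^{\frac{m-i+1}{m+1}}+Tz_{i+1,k+1}\quad(i=1,\dots,m),$$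 $$z_{m+1,k+1}\in z_{m+1,k}+T\lambda_{m+1}L\lfloor u_k-z_{1,k+1}\rceil^{0},$$ with outputs $y_{i,k}=\sum_{j=i}^{m}T^{j-i}c_{i,j}z_{j+1,k+1}$ for $i=1,\dots,m$. It is in discrete-time sliding mode at time index $k$ if the set formed by the right-hand sides of this system, evaluated at $(\mathbf z_k,\mathbf z_{k+1},u_k)$, contains more than one element. **Theorem.** Let $a_1,\dots,a_m\in(1,2)$. Put $\beta_1=1$, $\gamma_0=\gamma_1=2$, $\lambda_0=1$ and, for $j=1,\dots,m$, $$\beta_{j+1}=\Bigl(\beta_j^{j}+\frac{a_j}{\gamma_j^{j}}\Bigr)^{\frac1j},\qquad \gamma_{j+1}=\Bigl(\frac{2}{2-a_j}\Bigr)^{\frac1j}\gamma_j,\qquad \mu_j=\frac{j+1}{j}\cdot\frac{\gamma_j^{j}}{\gamma_{j-1}^{j-1}}\cdot\frac{\beta_{j+1}}{a_j-1}.$$ Suppose that the parameters $\lambda_1,\dots,\lambda_{m+1}>0$ satisfy $\lambda_{m+1}>1$ and $$\frac{\lambda_{m-j+1}}{\lambda_{m-j}}>\frac{\lambda_{m-j+2}}{\lambda_{m-j+1}}\,\mu_j\qquad(j=1,\dots,m).$$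 Let initial values $z_{1,1},\dots,z_{m+1,1}\in\mathbb R$ and a noise bound $N\ge0$ be given. Then for all $v_0,\dots,v_m\in\mathbb R$ there exists $K\in\mathbb N$, depending only on $m$, $L$, $T$, the $a_j$, the $\lambda_j$, the initial values, $N$ and $v_0,\dots,v_m$, such that the following holds for every $f\in\mathcal F_L^{(m)}$ with $f^{(i)}(0)=v_i$ ($i=0,\dots,m$) and every $(\eta_k)\in\mathcal E_N$. The IRED with input $u_k=f(kT)+\eta_k$ has a solution, and for every solution the outputs satisfy $$|y_{i,k}-f^{(i)}(kT)|\le c_{i,m+1}L\Bigl(T+d_i\sqrt[m+1]{N/L}\Bigr)^{m-i+1},\qquad d_i=\max_{p=1,\dots,m-i+1}\frac{\beta_p\gamma_{m+1}}{\sqrt[m+1]{2}}\sqrt[p]{\frac{\lambda_{m-p+1}c_{i,m-p+1}}{\binom{m-i+1}{p}c_{i,m+1}}},$$ for all $i=1,\dots,m$ and all $k\ge K$. If, in addition, $N\le\bar N$ with $$\bar N=\min_{p=0,\dots,m}\frac{LT^{m+1}}{2^{m}\beta_{m-p+1}^{m+1}\gamma_{m+1}^{m+1}}\Bigl(\frac{\lambda_{m+1}-1}{\lambda_p}\Bigr)^{\frac{m+1}{m-p+1}},$$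 then the differentiator is in discrete-time sliding mode, and $z_{1,k+1}=u_k$ holds, for all $k\ge K$. -/

import Mathlib

open Set MeasureTheory

noncomputable section

namespace IRED

/-- The signed power `|y|^p sign(y)`. -/
def spow (y p : ℝ) : ℝ := |y| ^ p * Real.sign y

/-- The set-valued sign: `{sign y}` for `y ≠ 0` and `[-1, 1]` for `y = 0`. -/
def signSet (y : ℝ) : Set ℝ := {s | (y ≠ 0 → s = Real.sign y) ∧ (y = 0 → s ∈ Icc (-1 : ℝ) 1)}

/-- The `i`th derivative of a signal on the time axis `[0, ∞)` (one-sided at `0`).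
Only the values of `f` on `[0, ∞)` matter. -/
def sigDeriv (i : ℕ) (f : ℝ → ℝ) (t : ℝ) : ℝ := iteratedDerivWithin i f (Ici 0) t

/-- Signals on `[0, ∞)` that are `m` times differentiable, with a Lipschitz continuous `m`th
derivative, and with `|f^(m+1)| ≤ L` almost everywhere on `[0, ∞)`. -/
def signals (m : ℕ) (L : ℝ) : Set (ℝ → ℝ) :=
  {f | (∀ j < m, DifferentiableOn ℝ (sigDeriv j f) (Ici 0)) ∧
    (∃ C : NNReal, LipschitzOnWith C (sigDeriv m f) (Ici 0)) ∧
    ∀ᵐ t ∂(volume.restrict (Ici (0 : ℝ))), |sigDeriv (m + 1) f t| ≤ L}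

/-- Noise sequences bounded by `N`. -/
def noises (N : ℝ) : Set (ℕ → ℝ) := {η | ∀ k, |η k| ≤ N}

/-- The sampled noisy measurements `u_k = f(kT) + η_k`. -/
def meas (T : ℝ) (f : ℝ → ℝ) (η : ℕ → ℝ) (k : ℕ) : ℝ := f (k * T) + η k

/-- The constants `c_{i,j}`:
`c_{i,j} = ((j-1) c_{i,j-1} + i c_{i-1,j-1}) / j` for `i, j ≥ 1`, with `c_{0,0} = 1` and
`c_{0,j} = c_{i,0} = 0` for `i, j ≠ 0`. -/
def c : ℕ → ℕ → ℝ
  | 0, 0 => 1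
  | 0, _ + 1 => 0
  | _ + 1, 0 => 0
  | i + 1, j + 1 => ((j : ℝ) * c (i + 1) j + ((i : ℝ) + 1) * c i j) / ((j : ℝ) + 1)

/-- The constants `γ_j`: `γ_0 = γ_1 = 2`, `γ_{j+1} = (2 / (2 - a_j))^(1/j) γ_j` for `j ≥ 1`. -/
def γ (a : ℕ → ℝ) : ℕ → ℝ
  | 0 => 2
  | 1 => 2
  | j + 2 => (2 / (2 - a (j + 1))) ^ (1 / ((j + 1 : ℕ) : ℝ)) * γ a (j + 1)

/-- The constants `β_j`: `β_1 = 1`, `β_{j+1} = (β_j^j + a_j / γ_j^j)^(1/j)` for `j ≥ 1`.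
The value at index `0` is not used. -/
def β (a : ℕ → ℝ) : ℕ → ℝ
  | 0 => 1
  | 1 => 1
  | j + 2 => (β a (j + 1) ^ (j + 1) + a (j + 1) / γ a (j + 1) ^ (j + 1)) ^ (1 / ((j + 1 : ℕ) : ℝ))

/-- The constants `μ_j`, used for `j ≥ 1`. -/
def μ (a : ℕ → ℝ) (j : ℕ) : ℝ :=
  ((j : ℝ) + 1) / j * (γ a j ^ j / γ a (j - 1) ^ (j - 1)) * (β a (j + 1) / (a j - 1))

/-- The constant `d_i`, used for `1 ≤ i ≤ m`. -/
def d (m : ℕ) (a lam : ℕ → ℝ) (i : ℕ) : ℝ :=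
  (Finset.Icc 1 (m - i + 1)).sup' (Finset.nonempty_Icc.mpr (Nat.le_add_left 1 (m - i)))
    fun p => β a p * γ a (m + 1) / (2 : ℝ) ^ (1 / ((m : ℝ) + 1)) *
      (lam (m + 1 - p) * c i (m + 1 - p) / (((m - i + 1).choose p : ℝ) * c i (m + 1))) ^
        (1 / (p : ℝ))

/-- The noise level `N̄` below which sliding mode is attained. -/
def Nbar (m : ℕ) (L T : ℝ) (a lam : ℕ → ℝ) : ℝ :=
  (Finset.range (m + 1)).inf' (Finset.nonempty_range_iff.mpr (Nat.succ_ne_zero m))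
    fun p => L * T ^ (m + 1) / (2 ^ m * β a (m + 1 - p) ^ (m + 1) * γ a (m + 1) ^ (m + 1)) *
      ((lam (m + 1) - 1) / lam p) ^ (((m : ℝ) + 1) / ((m + 1 - p : ℕ) : ℝ))

/-- The set-valued right-hand side `F_T(z, z', u)` of the implicit robust exact differentiator
`z_{k+1} ∈ F_T(z_k, z_{k+1}, u_k)`. Coordinates are numbered from zero: `z i` is the state
variable with number `i + 1`. -/
def rhs (m : ℕ) (L T : ℝ) (lam : ℕ → ℝ) (z z' : Fin (m + 1) → ℝ) (u : ℝ) :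
    Set (Fin (m + 1) → ℝ) :=
  {w | (∀ i : Fin m, w i.castSucc = z i.castSucc
      + T * lam (i + 1) * L ^ (((i : ℝ) + 1) / ((m : ℝ) + 1))
          * spow (u - z' 0) (((m : ℝ) - i) / ((m : ℝ) + 1))
      + T * z' i.succ) ∧
    ∃ s ∈ signSet (u - z' 0), w (Fin.last m) = z (Fin.last m) + T * lam (m + 1) * L * s}

/-- `z` is a solution sequence, with initial value `z_1 = z₁`, of the differentiator with
input `u`. (The entry `z 0` plays no role.) -/
def IsSolution (m : ℕ) (L T : ℝ) (lam : ℕ → ℝ) (z₁ : Fin (m + 1) → ℝ) (u : ℕ → ℝ)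
    (z : ℕ → Fin (m + 1) → ℝ) : Prop :=
  z 1 = z₁ ∧ ∀ k, 1 ≤ k → z (k + 1) ∈ rhs m L T lam (z k) (z (k + 1)) (u k)

/-- The output `y_{i,k} = ∑_{j=i}^m T^(j-i) c_{i,j} z_{j+1,k+1}`. -/
def output (m : ℕ) (T : ℝ) (z : ℕ → Fin (m + 1) → ℝ) (i k : ℕ) : ℝ :=
  ∑ j ∈ Finset.univ.filter (fun j : Fin (m + 1) => i ≤ (j : ℕ)),
    T ^ ((j : ℕ) - i) * c i j * z (k + 1) j

/-- Discrete-time sliding mode at time index `k`: the set `F_T(z_k, z_{k+1}, u_k)` contains more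
than one element. -/
def InSlidingMode (m : ℕ) (L T : ℝ) (lam : ℕ → ℝ) (u : ℕ → ℝ) (z : ℕ → Fin (m + 1) → ℝ)
    (k : ℕ) : Prop :=
  (rhs m L T lam (z k) (z (k + 1)) (u k)).Nontrivial

end IRED

end

noncomputable section

namespace IRED

open Filter Topology

/-! Extend the signal to negative times by its Taylor polynomial at 0. The scaled backward
differences of the extension (`refState`) satisfy the differentiator's implicit chain exactly,
without correction terms, up to a last increment `T * δ` with `|δ| ≤ L`
(`DerivChain.abs_iterate_bdiff_le`). Backward differences minus states therefore obey an error
system (`ErrorTraj`) driven only by the noise and by `δ`. Its initial value sees only the Taylor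
polynomial, which is why `K` is uniform in `f`.

The errors, reversed in order and scaled (`normalize`), are controlled by the maximum `lyap` of `|w
1|` and weighted roots of the deviations `dev w p`. The scheme is implicit, so the correction is
evaluated at the new state and a step is read backwards: whichever term attains the maximum after
the step, the maximum was larger before it, provided the noise is small relative to the new value.
Here `γ` carries the noise bound down the chain, `β` bounds the coordinates, and the condition with
`μ` says that the motion of `w (p + 1)` beats the drift of `w p`. On sublevel sets this gives
contraction by a fixed factor down to the noise level (`exists_lyap_decrease`, `exists_lyap_le`).

Eliminating all other unknowns leaves a scalar inclusion for `σ`, which forces `σ = 0` once its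
right-hand side is at most `T ^ (m + 1) * lam (m + 1) * L`; `Nbar` guarantees this
(`ErrorTraj.sliding`). For `N = 0` contraction alone never reaches zero, so the result for noise
level `Nbar` is used: it yields sliding mode, after which the errors vanish one after another.

The `c i j` are the power series coefficients of `(-log (1 - x)) ^ i`, so the outputs are
backward-difference derivatives with truncation error `c i (m + 1) * L * T ^ (m + 1)` (before
division by `T ^ i`; `DerivChain.abs_sub_sum_le`). The state errors are absorbed into a binomial
expansion, which is where `d` comes from (`le_d_pow`). -/

/-! ### Signed powers and the set-valued sign. -/

lemma spow_of_nonneg {y p : ℝ} (hp : 0 < p) (hy : 0 ≤ y) : spow y p = y ^ p := by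
  rcases hy.eq_or_lt with rfl | h
  · simp [spow, Real.zero_rpow hp.ne']
  · simp [spow, Real.sign_of_pos h, abs_of_pos h]

lemma spow_neg (y p : ℝ) : spow (-y) p = -spow y p := by
  simp [spow, Real.sign_neg]

lemma spow_of_nonpos {y p : ℝ} (hp : 0 < p) (hy : y ≤ 0) : spow y p = -(-y) ^ p := by
  rw [← spow_of_nonneg hp (neg_nonneg.2 hy), spow_neg, neg_neg]

@[simp] lemma spow_zero_left (p : ℝ) : spow 0 p = 0 := by simp [spow]

lemma spow_one (y : ℝ) : spow y 1 = y := by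
  rcases le_total 0 y with h | h
  · rw [spow_of_nonneg one_pos h, Real.rpow_one]
  · rw [spow_of_nonpos one_pos h, Real.rpow_one, neg_neg]

lemma abs_spow {p : ℝ} (hp : 0 < p) (y : ℝ) : |spow y p| = |y| ^ p := by
  rcases le_total 0 y with h | h
  · rw [spow_of_nonneg hp h, abs_of_nonneg h, abs_of_nonneg (Real.rpow_nonneg h p)]
  · have h' := neg_nonneg.2 h
    rw [spow_of_nonpos hp h, abs_of_nonpos h, abs_neg, abs_of_nonneg (Real.rpow_nonneg h' p)]

lemma spow_nonneg {y p : ℝ} (hp : 0 < p) (hy : 0 ≤ y) : 0 ≤ spow y p := by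
  rw [spow_of_nonneg hp hy]; exact Real.rpow_nonneg hy p

lemma spow_nonpos {y p : ℝ} (hp : 0 < p) (hy : y ≤ 0) : spow y p ≤ 0 := by
  rw [spow_of_nonpos hp hy]; exact neg_nonpos.2 (Real.rpow_nonneg (neg_nonneg.2 hy) p)

lemma spow_spow {p q : ℝ} (hp : 0 < p) (hq : 0 < q) (y : ℝ) :
    spow (spow y p) q = spow y (p * q) := by
  rcases le_total 0 y with h | h
  · rw [spow_of_nonneg hq (spow_nonneg hp h), spow_of_nonneg hp h,
      spow_of_nonneg (mul_pos hp hq) h, Real.rpow_mul h]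
  · have h' := neg_nonneg.2 h
    rw [spow_of_nonpos hq (spow_nonpos hp h), spow_of_nonpos hp h,
      spow_of_nonpos (mul_pos hp hq) h, neg_neg, Real.rpow_mul h']

lemma spow_mul_left {c p : ℝ} (hc : 0 < c) (hp : 0 < p) (y : ℝ) :
    spow (c * y) p = c ^ p * spow y p := by
  rcases le_total 0 y with h | h
  · rw [spow_of_nonneg hp (by positivity), spow_of_nonneg hp h, Real.mul_rpow hc.le h]
  · have h' := neg_nonneg.2 h
    rw [spow_of_nonpos hp (mul_nonpos_of_nonneg_of_nonpos hc.le h), spow_of_nonpos hp h,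
      ← mul_neg, Real.mul_rpow hc.le h', mul_neg]

lemma spow_monotone {p x y : ℝ} (hp : 0 < p) (hxy : x ≤ y) : spow x p ≤ spow y p := by
  rcases le_total 0 x with hx | hx
  · rw [spow_of_nonneg hp hx, spow_of_nonneg hp (hx.trans hxy)]
    exact Real.rpow_le_rpow hx hxy hp.le
  · rcases le_total 0 y with hy | hy
    · exact (spow_nonpos hp hx).trans (spow_nonneg hp hy)
    · rw [spow_of_nonpos hp hx, spow_of_nonpos hp hy]
      exact neg_le_neg (Real.rpow_le_rpow (neg_nonneg.2 hy) (neg_le_neg hxy) hp.le)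

lemma pos_of_spow_pos {y p : ℝ} (hp : 0 < p) (h : 0 < spow y p) : 0 < y := by
  by_contra! hy
  exact absurd (spow_nonpos hp hy) (not_le.2 h)

lemma continuousOn_spow {p : ℝ} (hp : 0 < p) : ContinuousOn (fun y => spow y p) (Ici 0) := by
  refine (Real.continuous_rpow_const hp.le).continuousOn.congr fun y hy => ?_
  exact spow_of_nonneg hp hy

/-- Hölder continuity of signed powers. -/
lemma abs_spow_sub_spow_le {q : ℝ} (hq : 0 < q) (hq1 : q ≤ 1) (x y : ℝ) :
    |spow x q - spow y q| ≤ 2 ^ (1 - q) * |x - y| ^ q := by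
  wlog hxy : y ≤ x generalizing x y
  · rw [abs_sub_comm, abs_sub_comm x]
    exact this y x (le_of_not_ge hxy)
  rw [abs_of_nonneg (sub_nonneg.2 (spow_monotone hq hxy)), abs_of_nonneg (sub_nonneg.2 hxy)]
  have key : ∀ u v : ℝ, 0 ≤ v → v ≤ u → u ^ q - v ^ q ≤ 2 ^ (1 - q) * (u - v) ^ q := by
    intro u v hv huv
    have h0 : 0 ≤ u - v := sub_nonneg.2 huv
    have h1 := Real.rpow_add_le_add_rpow h0 hv hq.le hq1
    rw [sub_add_cancel] at h1
    have h2 : (1 : ℝ) ≤ 2 ^ (1 - q) := Real.one_le_rpow one_le_two (by linarith)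
    nlinarith [Real.rpow_nonneg h0 q]
  rcases le_total 0 y with hy | hy
  · rw [spow_of_nonneg hq hy, spow_of_nonneg hq (hy.trans hxy)]
    exact key x y hy hxy
  · rcases le_total 0 x with hx | hx
    · rw [spow_of_nonneg hq hx, spow_of_nonpos hq hy]
      -- Opposite signs are the case that needs the factor `2 ^ (1 - q)`: concavity at the midpoint
      -- of `x` and `-y`.
      have h := (Real.concaveOn_rpow hq.le hq1).2 (mem_Ici.2 hx) (mem_Ici.2 (neg_nonneg.2 hy))
        (by norm_num : (0 : ℝ) ≤ 1 / 2) (by norm_num : (0 : ℝ) ≤ 1 / 2) (by norm_num)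
      simp only [smul_eq_mul] at h
      have h2 : (1 / 2 * x + 1 / 2 * -y) = 2⁻¹ * (x - y) := by ring
      rw [h2, Real.mul_rpow (by norm_num) (sub_nonneg.2 hxy), Real.inv_rpow (by norm_num)] at h
      rw [Real.rpow_sub two_pos, Real.rpow_one]
      have h3 : (0 : ℝ) < 2 ^ q := by positivity
      calc x ^ q - -(-y) ^ q = 2 * (1 / 2 * x ^ q + 1 / 2 * (-y) ^ q) := by ring
        _ ≤ 2 * ((2 ^ q)⁻¹ * (x - y) ^ q) := by linarith
        _ = _ := by ring
    · rw [spow_of_nonpos hq hx, spow_of_nonpos hq hy]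
      have := key (-y) (-x) (neg_nonneg.2 hx) (neg_le_neg hxy)
      rw [show -y - -x = x - y by ring] at this
      linarith

/-- Lower bound on the increments of a signed power with exponent at most one. -/
lemma le_spow_sub_spow {q B x y : ℝ} (hq : 0 < q) (hq1 : q ≤ 1) (hxy : x ≤ y)
    (hx : |x| ≤ B) (hy : |y| ≤ B) : q * B ^ (q - 1) * (y - x) ≤ spow y q - spow x q := by
  have key : ∀ u v : ℝ, 0 ≤ v → v ≤ u → u ≤ B → q * B ^ (q - 1) * (u - v) ≤ u ^ q - v ^ q := by
    intro u v hv huv huB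
    rcases (hv.trans huv).eq_or_lt with h0 | h0
    · have hv0 : v = 0 := by linarith
      simp [← h0, hv0]
    · have h1 := rpow_one_add_le_one_add_mul_self (s := v / u - 1)
        (by have := div_nonneg hv h0.le; linarith) hq.le hq1
      rw [add_sub_cancel, Real.div_rpow hv h0.le, div_le_iff₀ (Real.rpow_pos_of_pos h0 q)] at h1
      have h2 : u ^ q = u ^ (q - 1) * u := by
        rw [← Real.rpow_add_one h0.ne']; ring_nf
      have h3 : (1 + q * (v / u - 1)) * u ^ q = u ^ q - q * u ^ (q - 1) * (u - v) := by
        rw [h2]; field_simp; ring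
      have h4 : B ^ (q - 1) ≤ u ^ (q - 1) :=
        Real.rpow_le_rpow_of_nonpos h0 huB (by linarith)
      have h5 : q * B ^ (q - 1) * (u - v) ≤ q * u ^ (q - 1) * (u - v) := by
        have := sub_nonneg.2 huv
        gcongr
      linarith
  obtain ⟨hx1, -⟩ := abs_le.1 hx
  obtain ⟨-, hy2⟩ := abs_le.1 hy
  rcases le_total 0 x with h0 | h0
  · rw [spow_of_nonneg hq h0, spow_of_nonneg hq (h0.trans hxy)]
    exact key y x h0 hxy hy2
  · rcases le_total 0 y with h1 | h1
    · have k1 := key y 0 le_rfl h1 hy2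
      have k2 := key (-x) 0 le_rfl (by linarith) (by linarith)
      rw [Real.zero_rpow hq.ne'] at k1 k2
      rw [spow_of_nonneg hq h1, spow_of_nonpos hq h0]
      linarith
    · have k1 := key (-x) (-y) (by linarith) (by linarith) (by linarith)
      rw [spow_of_nonpos hq h1, spow_of_nonpos hq h0]
      linarith

lemma signSet_of_pos {y s : ℝ} (hy : 0 < y) (hs : s ∈ signSet y) : s = 1 := by
  rw [hs.1 hy.ne', Real.sign_of_pos hy]

lemma signSet_of_neg {y s : ℝ} (hy : y < 0) (hs : s ∈ signSet y) : s = -1 := by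
  rw [hs.1 hy.ne, Real.sign_of_neg hy]

lemma abs_le_one_of_mem_signSet {y s : ℝ} (hs : s ∈ signSet y) : |s| ≤ 1 := by
  rcases lt_trichotomy y 0 with h | h | h
  · rw [signSet_of_neg h hs]; simp
  · exact abs_le.2 (hs.2 h)
  · rw [signSet_of_pos h hs]; simp

/-! ### The constants `γ` and `β`. -/

section Constants

variable {m : ℕ} {a : ℕ → ℝ}

lemma γ_succ_pow (ha : ∀ j ∈ Finset.Icc 1 m, a j ∈ Ioo (1 : ℝ) 2) {p : ℕ} (h1 : 1 ≤ p)
    (hp : p ≤ m) : (2 - a p) * γ a (p + 1) ^ p = 2 * γ a p ^ p := by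
  obtain ⟨j, rfl⟩ : ∃ j, p = j + 1 := ⟨p - 1, by omega⟩
  have h := ha (j + 1) (Finset.mem_Icc.2 ⟨h1, hp⟩)
  have h2 : 0 < 2 - a (j + 1) := sub_pos.2 h.2
  rw [γ, mul_pow, one_div, Real.rpow_inv_natCast_pow (by positivity) (by omega)]
  field_simp

lemma two_le_γ (ha : ∀ j ∈ Finset.Icc 1 m, a j ∈ Ioo (1 : ℝ) 2) :
    ∀ p ≤ m + 1, 2 ≤ γ a p
  | 0, _ => by simp [γ]
  | 1, _ => by simp [γ]
  | j + 2, hp => by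
    have h := ha (j + 1) (Finset.mem_Icc.2 ⟨by omega, by omega⟩)
    have h2 : 0 < 2 - a (j + 1) := sub_pos.2 h.2
    have ih := two_le_γ ha (j + 1) (by omega)
    rw [γ]
    have : (1 : ℝ) ≤ (2 / (2 - a (j + 1))) ^ (1 / ((j + 1 : ℕ) : ℝ)) := by
      refine Real.one_le_rpow ?_ (by positivity)
      rw [le_div_iff₀ h2]; linarith [h.1]
    nlinarith

lemma γ_pos (ha : ∀ j ∈ Finset.Icc 1 m, a j ∈ Ioo (1 : ℝ) 2) {p : ℕ} (hp : p ≤ m + 1) :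
    0 < γ a p := two_pos.trans_le (two_le_γ ha p hp)

lemma one_le_β (ha : ∀ j ∈ Finset.Icc 1 m, a j ∈ Ioo (1 : ℝ) 2) :
    ∀ p ≤ m + 1, 1 ≤ β a p
  | 0, _ => by simp [β]
  | 1, _ => by simp [β]
  | j + 2, hp => by
    have h := ha (j + 1) (Finset.mem_Icc.2 ⟨by omega, by omega⟩)
    have ih := one_le_β ha (j + 1) (by omega)
    have hγ := γ_pos ha (p := j + 1) (by omega)
    rw [β]
    refine Real.one_le_rpow ?_ (by positivity)
    have h1 : 1 ≤ β a (j + 1) ^ (j + 1) := one_le_pow₀ ih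
    have h2 : 0 ≤ a (j + 1) / γ a (j + 1) ^ (j + 1) := by
      have := h.1; positivity
    linarith

lemma β_pos (ha : ∀ j ∈ Finset.Icc 1 m, a j ∈ Ioo (1 : ℝ) 2) {p : ℕ} (hp : p ≤ m + 1) :
    0 < β a p := one_pos.trans_le (one_le_β ha p hp)

lemma β_succ_pow (ha : ∀ j ∈ Finset.Icc 1 m, a j ∈ Ioo (1 : ℝ) 2) {p : ℕ} (h1 : 1 ≤ p)
    (hp : p ≤ m) : β a (p + 1) ^ p = β a p ^ p + a p / γ a p ^ p := by
  obtain ⟨j, rfl⟩ : ∃ j, p = j + 1 := ⟨p - 1, by omega⟩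
  have h := ha (j + 1) (Finset.mem_Icc.2 ⟨h1, hp⟩)
  have hγ := γ_pos ha (p := j + 1) (by omega)
  have hβ := β_pos ha (p := j + 1) (by omega)
  have := h.1
  rw [β, one_div, Real.rpow_inv_natCast_pow (by positivity) (by omega)]

end Constants

/-! ### The Lyapunov function and the geometry of its sublevel sets. -/

/-- The deviation of `⌊w_{p+1}⌉^{p/(p+1)}` from `w_p`. -/
def dev (w : ℕ → ℝ) (p : ℕ) : ℝ := spow (w (p + 1)) ((p : ℝ) / ((p : ℝ) + 1)) - w p

/-- `w` lies in the sublevel set of level `V` of the Lyapunov function. -/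
structure InLevel (m : ℕ) (a : ℕ → ℝ) (w : ℕ → ℝ) (V : ℝ) : Prop where
  nonneg : 0 ≤ V
  one : |w 1| ≤ V
  dev_le : ∀ p, 1 ≤ p → p ≤ m → |dev w p| ≤ a p * (V / γ a p) ^ p

/-- The expressions whose maximum is the Lyapunov function. -/
def lyapTerm (a : ℕ → ℝ) (w : ℕ → ℝ) (p : ℕ) : ℝ :=
  if p = 0 then |w 1| else γ a p * (|dev w p| / a p) ^ (1 / (p : ℝ))

/-- The Lyapunov function. -/
def lyap (m : ℕ) (a : ℕ → ℝ) (w : ℕ → ℝ) : ℝ :=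
  (Finset.range (m + 1)).sup' (Finset.nonempty_range_iff.mpr (Nat.succ_ne_zero m)) (lyapTerm a w)

section Lyapunov

variable {m : ℕ} {a : ℕ → ℝ} (ha : ∀ j ∈ Finset.Icc 1 m, a j ∈ Ioo (1 : ℝ) 2)
include ha

lemma abs_dev_eq (w : ℕ → ℝ) {p : ℕ} (h1 : 1 ≤ p) (hp : p ≤ m) :
    |dev w p| = a p * (lyapTerm a w p / γ a p) ^ p := by
  have h := (ha p (Finset.mem_Icc.2 ⟨h1, hp⟩)).1
  have hγ := γ_pos ha (p := p) (by omega)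
  have h0 : 0 ≤ |dev w p| / a p := by positivity
  rw [lyapTerm, if_neg (by omega), mul_div_cancel_left₀ _ hγ.ne', one_div,
    Real.rpow_inv_natCast_pow h0 (by omega)]
  field_simp

lemma lyapTerm_nonneg (w : ℕ → ℝ) {p : ℕ} (hp : p ≤ m) : 0 ≤ lyapTerm a w p := by
  rw [lyapTerm]
  split_ifs with h
  · exact abs_nonneg _
  · have h := (ha p (Finset.mem_Icc.2 ⟨by omega, hp⟩)).1
    have hγ := γ_pos ha (p := p) (by omega)
    positivity

omit ha in
lemma lyapTerm_le_lyap (w : ℕ → ℝ) {p : ℕ} (hp : p ≤ m) : lyapTerm a w p ≤ lyap m a w :=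
  Finset.le_sup' (lyapTerm a w) (Finset.mem_range.2 (by omega))

lemma lyap_nonneg (w : ℕ → ℝ) : 0 ≤ lyap m a w :=
  (lyapTerm_nonneg ha w (Nat.zero_le m)).trans (lyapTerm_le_lyap w (Nat.zero_le m))

lemma inLevel_of_lyap_le {w : ℕ → ℝ} {V : ℝ} (hV : lyap m a w ≤ V) : InLevel m a w V where
  nonneg := (lyap_nonneg ha w).trans hV
  one := by simpa [lyapTerm] using (lyapTerm_le_lyap w (Nat.zero_le m)).trans hV
  dev_le p h1 hp := by
    have h := (ha p (Finset.mem_Icc.2 ⟨h1, hp⟩)).1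
    have hγ := γ_pos ha (p := p) (by omega)
    have h0 := lyapTerm_nonneg ha w hp
    have h2 := (lyapTerm_le_lyap w hp).trans hV
    rw [abs_dev_eq ha w h1 hp]
    gcongr

/-- By induction: `|w (p + 1)| ^ (p / (p + 1))` is at most `|w p| + |dev w p|`, and adding the two
bounds is exactly the recursion of `β`. -/
lemma InLevel.abs_le {w : ℕ → ℝ} {V : ℝ} (h : InLevel m a w V) {p : ℕ} (h1 : 1 ≤ p)
    (hp : p ≤ m + 1) : |w p| ≤ (β a p * V) ^ p := by
  induction p, h1 using Nat.le_induction with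
  | base => simpa [β] using h.one
  | succ p h1 ih =>
    have hV := h.nonneg
    have hβ := β_pos ha (p := p + 1) hp
    have hd := h.dev_le p h1 (by omega)
    have hq : (0 : ℝ) < (p : ℝ) / ((p : ℝ) + 1) := by positivity
    have h2 : |spow (w (p + 1)) ((p : ℝ) / ((p : ℝ) + 1))| ≤ (β a (p + 1) * V) ^ p := by
      calc _ = |dev w p + w p| := by rw [dev, sub_add_cancel]
        _ ≤ a p * (V / γ a p) ^ p + (β a p * V) ^ p :=
          (abs_add_le _ _).trans (add_le_add hd (ih (by omega)))
        _ = _ := by rw [mul_pow, mul_pow, β_succ_pow ha h1 (by omega), div_pow]; ring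
    rw [abs_spow hq] at h2
    have h3 := Real.rpow_le_rpow (by positivity) h2
      (by positivity : (0 : ℝ) ≤ ((p : ℝ) + 1) / (p : ℝ))
    have hp0 : (p : ℝ) ≠ 0 := by positivity
    rw [← Real.rpow_mul (abs_nonneg _), ← Real.rpow_natCast, ← Real.rpow_mul (by positivity)] at h3
    rw [show (p : ℝ) / ((p : ℝ) + 1) * (((p : ℝ) + 1) / (p : ℝ)) = 1 by field_simp,
      show (p : ℝ) * (((p : ℝ) + 1) / (p : ℝ)) = ((p + 1 : ℕ) : ℝ) by push_cast; field_simp,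
      Real.rpow_one, Real.rpow_natCast] at h3
    exact h3

omit ha in
-- The Hölder constant `2 ^ (1 - q)` times `2 ^ q` is again 2, so a bound of this shape reproduces
-- itself along the chain.
lemma abs_spow_add_sub_spow_lt {p : ℕ} (h1 : 1 ≤ p) {w ν X : ℝ} (hX : 0 ≤ X)
    (hν : |ν| < 2 * X ^ (p + 1)) :
    |spow (w + ν) ((p : ℝ) / ((p : ℝ) + 1)) - spow w ((p : ℝ) / ((p : ℝ) + 1))| < 2 * X ^ p := by
  have hp : (0 : ℝ) < p := by exact_mod_cast h1
  have hq : (0 : ℝ) < (p : ℝ) / ((p : ℝ) + 1) := by positivity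
  have hq1 : (p : ℝ) / ((p : ℝ) + 1) ≤ 1 := by rw [div_le_one (by positivity)]; linarith
  have h2 := abs_spow_sub_spow_le hq hq1 (w + ν) w
  rw [add_sub_cancel_left] at h2
  refine h2.trans_lt ?_
  have h3 := Real.rpow_lt_rpow (abs_nonneg ν) hν hq
  have h4 : (0 : ℝ) < 2 ^ (1 - (p : ℝ) / ((p : ℝ) + 1)) := by positivity
  refine (mul_lt_mul_of_pos_left h3 h4).trans_eq ?_
  rw [Real.mul_rpow zero_le_two (by positivity), ← mul_assoc, ← Real.rpow_add two_pos,
    sub_add_cancel, Real.rpow_one, ← Real.rpow_natCast, ← Real.rpow_mul hX]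
  rw [show ((p + 1 : ℕ) : ℝ) * ((p : ℝ) / ((p : ℝ) + 1)) = p by push_cast; field_simp,
    Real.rpow_natCast]

/-- What `γ` is designed for: a budget of 2 at level `p + 1` costs only `2 - a p` at level `p`,
leaving `a p` for the deviation `dev w p`. -/
lemma two_mul_div_pow_succ {V : ℝ} {p : ℕ} (h1 : 1 ≤ p) (hp : p ≤ m) :
    2 * (V / γ a (p + 1)) ^ p = (2 - a p) * (V / γ a p) ^ p := by
  have h := γ_succ_pow ha h1 hp
  have hγ := γ_pos ha (p := p) (by omega)
  have hγ' := γ_pos ha (p := p + 1) (by omega)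
  rw [div_pow, div_pow]
  field_simp
  linear_combination (-V ^ p) * h

omit ha in
lemma spow_div_succ {p : ℕ} (h1 : 1 ≤ p) (σ : ℝ) :
    spow σ ((p : ℝ) / ((m : ℝ) + 1)) =
      spow (spow σ (((p + 1 : ℕ) : ℝ) / ((m : ℝ) + 1))) ((p : ℝ) / ((p : ℝ) + 1)) := by
  have hp : (0 : ℝ) < p := by exact_mod_cast h1
  rw [spow_spow (by positivity) (by positivity)]
  congr 1
  push_cast
  field_simp

/-- The deviation of `⌊σ⌉^{p/(m+1)}` from `w_p` in terms of the next one. -/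
lemma InLevel.abs_spow_sub_lt {w : ℕ → ℝ} {V σ : ℝ} (h : InLevel m a w V)
    (hσ : |σ - w (m + 1)| < 2 * (V / γ a (m + 1)) ^ (m + 1)) {p : ℕ} (h1 : 1 ≤ p)
    (hp : p ≤ m + 1) :
    |spow σ ((p : ℝ) / ((m : ℝ) + 1)) - w p| < 2 * (V / γ a p) ^ p := by
  revert h1
  induction hp using Nat.decreasingInduction with
  | self =>
    intro _
    rw [show ((m + 1 : ℕ) : ℝ) / ((m : ℝ) + 1) = 1 by push_cast; field_simp, spow_one]
    exact hσ
  | of_succ p hp ih =>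
    intro h1
    have ih := ih (by omega)
    have hV := h.nonneg
    have hγ' := γ_pos ha (p := p + 1) (by omega)
    have h2 := abs_spow_add_sub_spow_lt h1 (w := w (p + 1)) (by positivity) ih
    rw [add_sub_cancel, ← spow_div_succ h1, two_mul_div_pow_succ ha h1 (by omega)] at h2
    have h3 := h.dev_le p h1 (by omega)
    have h4 := (abs_add_le _ _).trans_lt (add_lt_add_of_lt_of_le h2 h3)
    rw [dev] at h4
    rw [sub_add_sub_cancel] at h4
    refine h4.trans_eq (by ring)

/-- Since `2 - a p < a p`, a deviation of extremal size `a p * (V / γ a p) ^ p` fixes the sign of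
the correction term and keeps it at least `2 * (a p - 1) * (V / γ a p) ^ p` in size. -/
lemma InLevel.le_abs_spow_sub {w : ℕ → ℝ} {V σ : ℝ} (h : InLevel m a w V)
    (hσ : |σ - w (m + 1)| < 2 * (V / γ a (m + 1)) ^ (m + 1)) {p : ℕ} (h1 : 1 ≤ p)
    (hp : p ≤ m) :
    |spow σ ((p : ℝ) / ((m : ℝ) + 1)) - w p - dev w p| ≤ (2 - a p) * (V / γ a p) ^ p := by
  have hV := h.nonneg
  have hγ' := γ_pos ha (p := p + 1) (by omega)
  have ih := h.abs_spow_sub_lt ha hσ (p := p + 1) (by omega) (by omega)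
  have h2 := abs_spow_add_sub_spow_lt h1 (w := w (p + 1)) (by positivity) ih
  rw [add_sub_cancel, ← spow_div_succ h1, two_mul_div_pow_succ ha h1 (by omega)] at h2
  rw [dev, sub_sub_sub_cancel_right]
  exact h2.le

end Lyapunov

/-! ### Decrease of the Lyapunov function in one step. -/

/-- One step of the normalized error dynamics, from `w` to `w'`. -/
structure ErrorStep (m : ℕ) (T ρ : ℝ) (κ : ℕ → ℝ) (w w' : ℕ → ℝ) (σ : ℝ) : Prop where
  one : ∃ s ∈ signSet σ, ∃ d, |d| ≤ ρ ∧ w' 1 = w 1 + T * κ 1 * (d - s)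
  succ : ∀ p, 1 ≤ p → p ≤ m →
    w' (p + 1) = w (p + 1) + T * κ (p + 1) * (w' p - spow σ ((p : ℝ) / ((m : ℝ) + 1)))

section Descent

variable {m : ℕ} {a : ℕ → ℝ} {T ρ : ℝ} {κ : ℕ → ℝ} {w w' : ℕ → ℝ} {σ : ℝ}

/-- The perturbation is too small to flip the sign of `w' 1`, so `σ` has this sign and the step has
pulled `w 1` towards zero against a disturbance of size at most `ρ`. -/
lemma ErrorStep.le_of_abs_one_eq (hs : ErrorStep m T ρ κ w w' σ) (hT : 0 < T) (hκ : 0 < κ 1)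
    {V : ℝ} (hV : |w' 1| = V) (hν : |spow σ (1 / ((m : ℝ) + 1)) - w' 1| < V) :
    V + T * κ 1 * (1 - ρ) ≤ |w 1| := by
  obtain ⟨s, hs, d, hd, h1⟩ := hs.one
  have hTκ := mul_pos hT hκ
  have hq : (0 : ℝ) < 1 / ((m : ℝ) + 1) := by positivity
  obtain ⟨hν1, hν2⟩ := abs_lt.1 hν
  obtain ⟨hd1, hd2⟩ := abs_le.1 hd
  rcases abs_cases (w' 1) with ⟨h, -⟩ | ⟨h, -⟩
  · have hσ : 0 < σ := pos_of_spow_pos hq (by linarith)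
    rw [signSet_of_pos hσ hs] at h1
    have : T * κ 1 * (1 - ρ) ≤ T * κ 1 * (1 - d) := by gcongr
    refine le_trans ?_ (le_abs_self _)
    linarith
  · have hσ : 0 < -σ := pos_of_spow_pos hq (by rw [spow_neg]; linarith)
    rw [signSet_of_neg (neg_pos.1 hσ) hs] at h1
    have : T * κ 1 * (1 - ρ) ≤ T * κ 1 * (1 + d) := by gcongr; linarith
    refine le_trans ?_ (neg_le_abs _)
    linarith

/-- Backward reading of a step with deviation at least `D` afterwards: before it, `x` was further
out by at least `A`, which the minimal slope of the signed power on `[-B, B]` converts into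
deviation, while `y` can have offset at most `Y` of this. -/
lemma le_abs_spow_sub_of_step {q B A Y x x' y y' D : ℝ} (hq : 0 < q) (hq1 : q ≤ 1)
    (hx : |x| ≤ B) (hx' : |x'| ≤ B) (hA : 0 ≤ A) (hxx' : A ≤ x - x') (hy : |y - y'| ≤ Y)
    (hD : D ≤ spow x' q - y') : D + q * B ^ (q - 1) * A - Y ≤ |spow x q - y| := by
  have hB : 0 ≤ B := (abs_nonneg _).trans hx
  have h1 := le_spow_sub_spow hq hq1 (by linarith : x' ≤ x) hx' hx
  have h2 : q * B ^ (q - 1) * A ≤ q * B ^ (q - 1) * (x - x') := by gcongr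
  have := (abs_le.1 hy).2
  refine le_trans ?_ (le_abs_self _)
  linarith

variable (ha : ∀ j ∈ Finset.Icc 1 m, a j ∈ Ioo (1 : ℝ) 2)
include ha

lemma ErrorStep.abs_sub_le (hs : ErrorStep m T ρ κ w w' σ) (hT : 0 < T) (hκ : ∀ p, 1 ≤ p →
    p ≤ m + 1 → 0 < κ p) (hρ : ρ ≤ 1) {V : ℝ} (h' : InLevel m a w' V)
    (hσ : |σ - w' (m + 1)| < 2 * (V / γ a (m + 1)) ^ (m + 1)) {p : ℕ} (h1 : 1 ≤ p) (hp : p ≤ m) :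
    |w p - w' p| ≤ T * (2 * κ p * (V / γ a (p - 1)) ^ (p - 1)) := by
  have hκp := hκ p h1 (by omega)
  rcases h1.eq_or_lt with rfl | h2
  · obtain ⟨s, hs, d, hd, h1⟩ := hs.one
    have hs1 := abs_le_one_of_mem_signSet hs
    have : |d - s| ≤ 2 := by
      rw [abs_le] at *
      constructor <;> linarith
    rw [h1, sub_add_cancel_left, abs_neg, abs_mul, abs_of_pos (by positivity)]
    have h3 : T * κ 1 * |d - s| ≤ T * κ 1 * 2 := by gcongr
    simp only [Nat.sub_self, pow_zero]
    linarith
  · obtain ⟨j, rfl⟩ : ∃ j, p = j + 1 := ⟨p - 1, by omega⟩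
    have h3 := hs.succ j (by omega) (by omega)
    have h4 := (h'.abs_spow_sub_lt ha hσ (p := j) (by omega) (by omega)).le
    rw [h3, sub_add_cancel_left, abs_neg, abs_mul, abs_of_pos (by positivity), abs_sub_comm]
    calc _ ≤ T * κ (j + 1) * (2 * (V / γ a j) ^ j) := by gcongr
      _ = _ := by rw [Nat.add_sub_cancel]; ring

/-- `R` bounds both the old and the new level because it is not yet known which is larger; it fixes
the ball on which the slope of the signed power is estimated. -/
lemma ErrorStep.le_of_abs_dev_eq (hs : ErrorStep m T ρ κ w w' σ) (hT : 0 < T) (hκ : ∀ p, 1 ≤ p →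
    p ≤ m + 1 → 0 < κ p) (hρ : ρ ≤ 1) {U V R : ℝ} (hV : 0 < V) (h' : InLevel m a w' V)
    (hσ : |σ - w' (m + 1)| < 2 * (V / γ a (m + 1)) ^ (m + 1)) (h : InLevel m a w U) {p : ℕ}
    (h1 : 1 ≤ p) (hp : p ≤ m) (heq : |dev w' p| = a p * (V / γ a p) ^ p) (hUR : U ≤ R)
    (hVR : V ≤ R) :
    a p * (V / γ a p) ^ p + (p : ℝ) / ((p : ℝ) + 1) * (β a (p + 1) * R)⁻¹ *
      (T * κ (p + 1) * (2 * (a p - 1) * (V / γ a p) ^ p)) -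
      T * (2 * κ p * (V / γ a (p - 1)) ^ (p - 1)) ≤ a p * (U / γ a p) ^ p := by
  have hap := (ha p (Finset.mem_Icc.2 ⟨h1, hp⟩)).1
  have hγ := γ_pos ha (p := p) (by omega)
  have hβ := β_pos ha (p := p + 1) (by omega)
  have hκp := hκ (p + 1) (by omega) (by omega)
  have hR : 0 < R := hV.trans_le hVR
  have hp0 : (0 : ℝ) < p := by exact_mod_cast h1
  have hq : (0 : ℝ) < (p : ℝ) / ((p : ℝ) + 1) := by positivity
  have hq1 : (p : ℝ) / ((p : ℝ) + 1) ≤ 1 := by rw [div_le_one (by positivity)]; linarith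
  have hx : |w (p + 1)| ≤ (β a (p + 1) * R) ^ (p + 1) := by
    have := h.nonneg
    refine (h.abs_le ha (by omega) (by omega)).trans ?_
    gcongr
  have hx' : |w' (p + 1)| ≤ (β a (p + 1) * R) ^ (p + 1) := by
    refine (h'.abs_le ha (by omega) (by omega)).trans ?_
    gcongr
  have hy := hs.abs_sub_le ha hT hκ hρ h' hσ h1 hp
  have hB : ((β a (p + 1) * R) ^ (p + 1)) ^ ((p : ℝ) / ((p : ℝ) + 1) - 1) =
      (β a (p + 1) * R)⁻¹ := by
    rw [← Real.rpow_natCast, ← Real.rpow_mul (by positivity), ← Real.rpow_neg_one]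
    congr 1
    push_cast
    field_simp
    ring
  have hd := h.dev_le p h1 hp
  have hν := h'.le_abs_spow_sub ha hσ h1 hp
  have hstep := hs.succ p h1 hp
  obtain ⟨hν1, hν2⟩ := abs_le.1 hν
  have hA : 0 ≤ T * κ (p + 1) * (2 * (a p - 1) * (V / γ a p) ^ p) := by
    have : 0 < a p - 1 := sub_pos.2 hap
    positivity
  rw [← hB]
  have hTκ : 0 < T * κ (p + 1) := by positivity
  refine le_trans ?_ hd
  rcases abs_cases (dev w' p) with ⟨hc, -⟩ | ⟨hc, -⟩
  · refine le_abs_spow_sub_of_step hq hq1 hx hx' hA ?_ hy (by rw [← heq, hc, dev])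
    calc _ ≤ T * κ (p + 1) * (spow σ ((p : ℝ) / ((m : ℝ) + 1)) - w' p) :=
          mul_le_mul_of_nonneg_left (by linarith) hTκ.le
      _ = _ := by rw [hstep]; ring
  · have hneg : |dev w p| = |spow (-w (p + 1)) ((p : ℝ) / ((p : ℝ) + 1)) - -w p| := by
      rw [← abs_neg, dev, spow_neg]
      congr 1
      ring
    rw [hneg]
    refine le_abs_spow_sub_of_step (x' := -w' (p + 1)) (y' := -w' p) hq hq1
      (by rwa [abs_neg]) (by rwa [abs_neg]) hA ?_ ?_ ?_
    · calc _ ≤ T * κ (p + 1) * (-(spow σ ((p : ℝ) / ((m : ℝ) + 1)) - w' p)) :=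
          mul_le_mul_of_nonneg_left (by linarith) hTκ.le
      _ = _ := by rw [hstep]; ring
    · rwa [neg_sub_neg, abs_sub_comm]
    · rw [← heq, hc, dev, spow_neg]; linarith

end Descent

/-- If `U ≤ V`, then `C₂ < C₁` contradicts the inequality at once. If `V ≤ U < r * V`, then `V / U >
1 / r`, so for `r` near 1 the gain is still positive, and `U ≤ U₀` makes it proportional to `V ^ p`,
too large for `U < r * V`. -/
lemma eventually_mul_le_of_decrease {α C₁ C₂ T U₀ : ℝ} (hα : 0 < α) (hC₂ : 0 ≤ C₂) (hC : C₂ < C₁)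
    (hT : 0 < T) (hU₀ : 0 < U₀) {p : ℕ} (hp : 1 ≤ p) :
    ∀ᶠ r in 𝓝[>] (1 : ℝ), ∀ U V : ℝ, 0 < V → 0 ≤ U → U ≤ U₀ →
      α * V ^ p + T * V ^ (p - 1) * (C₁ * V / max U V - C₂) ≤ α * U ^ p → r * V ≤ U := by
  have hcont : ContinuousAt (fun r : ℝ => α * (r ^ p - 1) - T / U₀ * (C₁ / r - C₂)) 1 := by
    have : ContinuousAt (fun r : ℝ => C₁ / r) 1 :=
      continuousAt_const.div continuousAt_id one_ne_zero
    fun_prop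
  have hneg : α * ((1 : ℝ) ^ p - 1) - T / U₀ * (C₁ / 1 - C₂) < 0 := by
    have : 0 < T / U₀ * (C₁ - C₂) := mul_pos (div_pos hT hU₀) (sub_pos.2 hC)
    simp only [one_pow, sub_self, mul_zero, div_one]
    linarith
  filter_upwards [nhdsWithin_le_nhds (hcont.eventually_lt_const hneg), self_mem_nhdsWithin]
    with r hr hr1 U V hV hU hUU₀ h
  have hr1 : 1 < r := hr1
  by_contra! hlt
  obtain ⟨j, rfl⟩ : ∃ j, p = j + 1 := ⟨p - 1, by omega⟩
  have hVj : 0 < V ^ j := by positivity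
  rw [Nat.add_sub_cancel] at h
  rcases le_total U V with hUV | hVU
  · rw [max_eq_right hUV, mul_div_cancel_right₀ _ hV.ne'] at h
    have h1 : U ^ (j + 1) ≤ V ^ (j + 1) := by gcongr
    have h2 : 0 < T * V ^ j * (C₁ - C₂) := mul_pos (by positivity) (sub_pos.2 hC)
    nlinarith
  · rw [max_eq_left hVU] at h
    have hU' : 0 < U := hV.trans_le hVU
    have h1 : U ^ (j + 1) ≤ (r * V) ^ (j + 1) := by gcongr
    have hr0 : (0 : ℝ) < r := by linarith
    have hC₁ : 0 ≤ C₁ := by linarith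
    have h2 : C₁ / r ≤ C₁ * V / U := by
      rw [div_le_div_iff₀ hr0 hU']
      nlinarith
    have h3 : (1 : ℝ) ≤ r ^ (j + 1) := one_le_pow₀ hr1.le
    have h4 : 0 < T / U₀ * (C₁ / r - C₂) := by nlinarith
    have h5 : 0 < C₁ / r - C₂ := (pos_iff_pos_of_mul_pos h4).1 (by positivity)
    have h6 : T * V ^ j * (C₁ / r - C₂) ≤ T * V ^ j * (C₁ * V / U - C₂) := by gcongr
    have h7 : V ^ (j + 1) * (T / U₀ * (C₁ / r - C₂)) ≤ T * V ^ j * (C₁ / r - C₂) := by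
      have : V / U₀ ≤ 1 := by rw [div_le_one hU₀]; linarith
      calc _ = (T * V ^ j * (C₁ / r - C₂)) * (V / U₀) := by ring
        _ ≤ (T * V ^ j * (C₁ / r - C₂)) * 1 := by gcongr
        _ = _ := mul_one _
    have h8 : V ^ (j + 1) * (α * (r ^ (j + 1) - 1)) <
        V ^ (j + 1) * (T / U₀ * (C₁ / r - C₂)) := by
      exact mul_lt_mul_of_pos_left (by linarith) (by positivity)
    rw [mul_pow] at h1
    nlinarith

/-! ### Contraction and finite-time convergence to the noise level. -/

section Convergence

variable {m : ℕ} {a : ℕ → ℝ} {T ρ : ℝ} {κ : ℕ → ℝ}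

/-- On sublevel sets, one step reduces the Lyapunov function by a constant factor unless the noise
is large compared to its new value. -/
lemma exists_lyap_decrease (ha : ∀ j ∈ Finset.Icc 1 m, a j ∈ Ioo (1 : ℝ) 2) (hT : 0 < T)
    (hκ : ∀ p, 1 ≤ p → p ≤ m + 1 → 0 < κ p) (hρ : ρ < 1)
    (hcond : ∀ p, 1 ≤ p → p ≤ m → κ p * μ a p < κ (p + 1)) {U₀ : ℝ} (hU₀ : 0 < U₀) :
    ∃ r : ℝ, 1 < r ∧ ∀ w w' σ, ErrorStep m T ρ κ w w' σ → lyap m a w ≤ U₀ →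
      |σ - w' (m + 1)| < 2 * (lyap m a w' / γ a (m + 1)) ^ (m + 1) →
      r * lyap m a w' ≤ lyap m a w := by
  have hκ1 := hκ 1 le_rfl (by omega)
  -- Each of the finitely many terms of the maximum admits every `r` slightly above 1, hence a
  -- common `r` exists.
  have h0 : ∀ᶠ r in 𝓝[>] (1 : ℝ), r < 1 + T * κ 1 * (1 - ρ) / U₀ := by
    refine nhdsWithin_le_nhds (eventually_lt_nhds ?_)
    have : 0 < T * κ 1 * (1 - ρ) / U₀ := by
      have := sub_pos.2 hρ
      positivity
    linarith
  have hp : ∀ᶠ r in 𝓝[>] (1 : ℝ), ∀ p ∈ Finset.Icc 1 m, ∀ U V : ℝ, 0 < V → 0 ≤ U → U ≤ U₀ →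
      a p / γ a p ^ p * V ^ p + T * V ^ (p - 1) *
        ((p : ℝ) / ((p : ℝ) + 1) * (2 * κ (p + 1) * (a p - 1)) / (β a (p + 1) * γ a p ^ p) * V
          / max U V - 2 * κ p / γ a (p - 1) ^ (p - 1)) ≤ a p / γ a p ^ p * U ^ p → r * V ≤ U := by
    rw [eventually_all_finset]
    intro p hp
    have hap := (ha p hp).1
    obtain ⟨h1, hpm⟩ := Finset.mem_Icc.1 hp
    have hγ := γ_pos ha (p := p) (by omega)
    have hγ' := γ_pos ha (p := p - 1) (by omega)
    have hβ := β_pos ha (p := p + 1) (by omega)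
    have hκp := hκ p h1 (by omega)
    have hp0 : (0 : ℝ) < p := by exact_mod_cast h1
    refine eventually_mul_le_of_decrease (by positivity) (by positivity) ?_ hT hU₀ h1
    have hap' := sub_pos.2 hap
    -- The remaining inequality `C₂ < C₁` is the hypothesis with `μ`, up to positive factors.
    have h := hcond p h1 hpm
    rw [μ] at h
    rw [div_lt_div_iff₀ (by positivity) (by positivity)]
    have h2 := mul_lt_mul_of_pos_left h (by positivity : 0 < (p : ℝ) / ((p : ℝ) + 1) *
      (2 * (a p - 1)) * γ a (p - 1) ^ (p - 1))
    refine Eq.trans_lt ?_ (h2.trans_eq (by ring))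
    field_simp
  obtain ⟨r, ⟨hr0, hr⟩, hr1⟩ := ((h0.and hp).and self_mem_nhdsWithin).exists
  have hr1 : 1 < r := hr1
  refine ⟨r, hr1, fun w w' σ hs hU hσ => ?_⟩
  set U := lyap m a w
  set V := lyap m a w' with hVdef
  have h : InLevel m a w U := inLevel_of_lyap_le ha le_rfl
  have h' : InLevel m a w' V := inLevel_of_lyap_le ha le_rfl
  have hγm := γ_pos ha (p := m + 1) le_rfl
  have hV : 0 < V := by
    refine h'.nonneg.lt_of_ne fun h0 => ?_
    rw [← h0, zero_div, zero_pow (by omega), mul_zero] at hσ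
    exact absurd hσ (not_lt.2 (abs_nonneg _))
  obtain ⟨p, hpm, hpeq⟩ := Finset.exists_mem_eq_sup' (s := Finset.range (m + 1))
    (Finset.nonempty_range_iff.mpr (Nat.succ_ne_zero m)) (lyapTerm a w')
  rw [← lyap, ← hVdef] at hpeq
  have hpm : p ≤ m := by have := Finset.mem_range.1 hpm; omega
  rcases p.eq_zero_or_pos with rfl | h1
  · have hone : |w' 1| = V := by rw [hpeq]; simp [lyapTerm]
    have hν := h'.abs_spow_sub_lt ha hσ le_rfl (by omega)
    -- As `γ a 1 = 2`, the perturbation bound `2 * (V / γ a 1)` is `V` itself.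
    simp only [Nat.cast_one, pow_one, γ] at hν
    have h2 := hs.le_of_abs_one_eq hT hκ1 hone (by linarith)
    have h3 := h2.trans h.one
    have hd : 0 < T * κ 1 * (1 - ρ) := by
      have := sub_pos.2 hρ
      positivity
    have hVU₀ : V ≤ U₀ := by linarith
    calc r * V ≤ (1 + T * κ 1 * (1 - ρ) / U₀) * V := by gcongr
      _ = V + T * κ 1 * (1 - ρ) * (V / U₀) := by ring
      _ ≤ V + T * κ 1 * (1 - ρ) * 1 := by
        gcongr
        rwa [div_le_one hU₀]
      _ ≤ U := by linarith
  · have hdev : |dev w' p| = a p * (V / γ a p) ^ p := by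
      rw [abs_dev_eq ha w' h1 hpm, hpeq]
    have hγ := γ_pos ha (p := p) (by omega)
    have hγ' := γ_pos ha (p := p - 1) (by omega)
    have hβ := β_pos ha (p := p + 1) (by omega)
    have hR : 0 < max U V := hV.trans_le (le_max_right _ _)
    have h2 := hs.le_of_abs_dev_eq ha hT hκ hρ.le hV h' hσ h h1 hpm hdev (le_max_left U V)
      (le_max_right U V)
    refine hr p (Finset.mem_Icc.2 ⟨h1, hpm⟩) U V hV h.nonneg hU ?_
    obtain ⟨j, rfl⟩ : ∃ j, p = j + 1 := ⟨p - 1, by omega⟩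
    rw [div_pow, div_pow, div_pow] at h2
    simp only [Nat.add_sub_cancel] at h2 ⊢
    convert h2 using 1
    · rw [mul_inv]
      generalize (max U V) = R
      field_simp
      ring
    · ring

/-- Uniform finite-time convergence of the error to a sublevel set determined by the noise. -/
lemma exists_lyap_le (ha : ∀ j ∈ Finset.Icc 1 m, a j ∈ Ioo (1 : ℝ) 2) (hT : 0 < T)
    (hκ : ∀ p, 1 ≤ p → p ≤ m + 1 → 0 < κ p) (hρ : ρ < 1)
    (hcond : ∀ p, 1 ≤ p → p ≤ m → κ p * μ a p < κ (p + 1)) (U₀ : ℝ) {M : ℝ} (hM : 0 < M) :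
    ∃ K : ℕ, 1 ≤ K ∧ ∀ (w : ℕ → ℕ → ℝ) (σ : ℕ → ℝ), lyap m a (w 1) ≤ U₀ →
      (∀ k, 1 ≤ k → ErrorStep m T ρ κ (w k) (w (k + 1)) (σ k)) →
      (∀ k, 1 ≤ k → |σ k - w (k + 1) (m + 1)| ≤ 2 * (M / γ a (m + 1)) ^ (m + 1)) →
      ∀ k, K ≤ k → lyap m a (w k) ≤ M := by
  set U₁ := max U₀ M with hU₁
  have hU₁M : M ≤ U₁ := le_max_right _ _
  obtain ⟨r, hr1, hr⟩ := exists_lyap_decrease ha hT hκ hρ hcond (hM.trans_le hU₁M)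
  have hγ := γ_pos ha (p := m + 1) le_rfl
  have hr0 : 0 < r := by linarith
  obtain ⟨n, hn⟩ := pow_unbounded_of_one_lt (U₁ / M) hr1
  refine ⟨n + 1, by omega, fun w σ h0 hs hσ => ?_⟩
  have main : ∀ j, lyap m a (w (j + 1)) ≤ max M (U₁ / r ^ j) := by
    intro j
    induction j with
    | zero =>
      rw [pow_zero, div_one]
      exact (h0.trans (le_max_left U₀ M)).trans (le_max_right _ _)
    | succ j ih =>
      by_cases hlt : lyap m a (w (j + 1 + 1)) ≤ M
      · exact hlt.trans (le_max_left _ _)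
      · push Not at hlt
        have hU : lyap m a (w (j + 1)) ≤ U₁ := by
          refine ih.trans (max_le hU₁M (div_le_self (hM.le.trans hU₁M) (one_le_pow₀ hr1.le)))
        have h1 := hr _ _ _ (hs (j + 1) (by omega)) hU ((hσ (j + 1) (by omega)).trans_lt (by gcongr))
        refine le_trans ?_ (le_max_right _ _)
        -- A new value above `M` requires an even larger old one, so the level `M` is never left
        -- once reached.
        have h2 : M < lyap m a (w (j + 1)) := by nlinarith
        have h3 := (le_max_iff.1 ih).resolve_left (not_le.2 h2)
        rw [pow_succ, ← div_div, le_div_iff₀ hr0, mul_comm]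
        exact h1.trans h3
  intro k hk
  obtain ⟨j, rfl⟩ : ∃ j, k = j + 1 := ⟨k - 1, by omega⟩
  refine (main j).trans (max_le le_rfl ?_)
  have : r ^ n ≤ r ^ j := pow_le_pow_right₀ hr1.le (by omega)
  rw [div_le_iff₀ (by positivity)]
  rw [div_lt_iff₀ hM] at hn
  nlinarith

end Convergence

/-! ### Numerical differentiation by backward differences. -/

/-- The backward difference with step `T`. -/
def bdiff (T : ℝ) (g : ℝ → ℝ) (x : ℝ) : ℝ := g x - g (x - T)

/-- `g 0, …, g m` are successive derivatives, and the last one is Lipschitz with constant `L`. -/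
structure DerivChain (m : ℕ) (L : ℝ) (g : ℕ → ℝ → ℝ) : Prop where
  hasDerivAt : ∀ i < m, ∀ t, HasDerivAt (g i) (g (i + 1) t) t
  lip : ∀ s t, |g m s - g m t| ≤ L * |s - t|

lemma DerivChain.continuous {m : ℕ} {L : ℝ} {g : ℕ → ℝ → ℝ} (h : DerivChain m L g) {i : ℕ}
    (hi : i ≤ m) : Continuous (g i) := by
  rcases hi.lt_or_eq with hi | rfl
  · exact continuous_iff_continuousAt.2 fun t => (h.hasDerivAt i hi t).continuousAt
  · refine (LipschitzWith.of_dist_le_mul (K := L.toNNReal) fun s t => ?_).continuous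
    rw [Real.dist_eq, Real.dist_eq]
    refine (h.lip s t).trans ?_
    gcongr
    exact Real.le_coe_toNNReal L

lemma DerivChain.bdiff {m : ℕ} {L T : ℝ} (hT : 0 ≤ T) {g : ℕ → ℝ → ℝ}
    (h : DerivChain (m + 1) L g) : DerivChain m (L * T) fun i => bdiff T (g i) := by
  have hd : ∀ i < m + 1, ∀ t, HasDerivAt (IRED.bdiff T (g i)) (IRED.bdiff T (g (i + 1)) t) t :=
    fun i hi t => (h.hasDerivAt i hi t).sub ((h.hasDerivAt i hi (t - T)).comp_sub_const t T)
  refine ⟨fun i hi t => hd i (by omega) t, fun s t => ?_⟩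
  refine convex_univ.norm_image_sub_le_of_norm_hasDerivWithin_le
    (fun x _ => (hd m (by omega) x).hasDerivWithinAt) (fun x _ => ?_) (mem_univ t) (mem_univ s)
  refine (h.lip x (x - T)).trans_eq ?_
  rw [sub_sub_cancel, abs_of_nonneg hT]

lemma DerivChain.abs_iterate_bdiff_le {m : ℕ} {L T : ℝ} (hT : 0 ≤ T) {g : ℕ → ℝ → ℝ}
    (h : DerivChain m L g) (x : ℝ) : |(IRED.bdiff T)^[m + 1] (g 0) x| ≤ L * T ^ (m + 1) := by
  induction m generalizing L g with
  | zero =>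
    refine (h.lip x (x - T)).trans_eq ?_
    rw [sub_sub_cancel, abs_of_nonneg hT, zero_add, pow_one]
  | succ m ih =>
    rw [Function.iterate_succ_apply]
    refine (ih (h.bdiff hT)).trans_eq ?_
    ring

/-- A discrete Leibniz rule. It is applied at `x = t₀`, where the first term drops out. -/
lemma iterate_bdiff_mul (T t₀ : ℝ) (h : ℝ → ℝ) (j : ℕ) (x : ℝ) :
    (bdiff T)^[j + 1] (fun y => (y - t₀) * h y) x =
      (x - t₀) * (bdiff T)^[j + 1] h x + (j + 1) * T * (bdiff T)^[j] h (x - T) := by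
  induction j generalizing x with
  | zero => simp [bdiff]; ring
  | succ j ih =>
    rw [Function.iterate_succ_apply', bdiff, ih, ih, Function.iterate_succ_apply' _ (j + 1) h,
      bdiff]
    have : (bdiff T)^[j + 1] h (x - T) = (bdiff T)^[j] h (x - T) - (bdiff T)^[j] h (x - T - T) := by
      rw [Function.iterate_succ_apply', bdiff]
    push_cast
    rw [this]
    ring

lemma iterate_bdiff_sub_const (T C : ℝ) (g : ℝ → ℝ) (j : ℕ) :
    (bdiff T)^[j + 1] (fun y => g y - C) = (bdiff T)^[j + 1] g := by
  rw [Function.iterate_succ_apply, Function.iterate_succ_apply]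
  congr 1
  ext x
  simp [bdiff]

/-- Backward differences look only into the past, so at time 0 they cannot distinguish the extended
signal from its Taylor polynomial. -/
lemma iterate_bdiff_congr {T : ℝ} (hT : 0 ≤ T) {g h : ℝ → ℝ} (hgh : ∀ t ≤ 0, g t = h t) (j : ℕ) :
    ∀ t ≤ 0, (bdiff T)^[j] g t = (bdiff T)^[j] h t := by
  induction j with
  | zero => exact hgh
  | succ j ih =>
    intro t ht
    rw [Function.iterate_succ_apply', Function.iterate_succ_apply', bdiff, bdiff, ih t ht,
      ih (t - T) (by linarith)]

/-- The successive derivatives of the difference quotient `(g x - g t₀) / (x - t₀)`. -/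
def slopeChain (g : ℕ → ℝ → ℝ) (t₀ : ℝ) (i : ℕ) (x : ℝ) : ℝ :=
  ∫ s in (0 : ℝ)..1, s ^ i * g (i + 1) (t₀ + s * (x - t₀))

lemma slopeChain_self (g : ℕ → ℝ → ℝ) (t₀ : ℝ) (i : ℕ) :
    ((i : ℝ) + 1) * slopeChain g t₀ i t₀ = g (i + 1) t₀ := by
  simp only [slopeChain, sub_self, mul_zero, add_zero, intervalIntegral.integral_mul_const,
    integral_pow, one_pow]
  have : (i : ℝ) + 1 ≠ 0 := by positivity
  simp
  field_simp

section Slope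

variable {m : ℕ} {L : ℝ} {g : ℕ → ℝ → ℝ}

lemma DerivChain.sub_eq_mul_slopeChain (h : DerivChain (m + 1) L g) (t₀ x : ℝ) :
    g 0 x - g 0 t₀ = (x - t₀) * slopeChain g t₀ 0 x := by
  have hc := h.continuous (i := 1) (by omega)
  have h1 : ∀ s ∈ uIcc (0 : ℝ) 1, HasDerivAt (fun s => g 0 (t₀ + s * (x - t₀)))
      (g 1 (t₀ + s * (x - t₀)) * (x - t₀)) s := by
    intro s _
    have hin : HasDerivAt (fun s : ℝ => t₀ + s * (x - t₀)) (x - t₀) s := by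
      simpa using ((hasDerivAt_id s).mul_const (x - t₀)).const_add t₀
    exact (h.hasDerivAt 0 (by omega) _).comp s hin
  have h2 := intervalIntegral.integral_eq_sub_of_hasDerivAt h1
    (Continuous.intervalIntegrable (by fun_prop) _ _)
  rw [intervalIntegral.integral_mul_const] at h2
  simp only [one_mul, zero_mul, add_zero, add_sub_cancel] at h2
  rw [← h2, slopeChain, mul_comm]
  simp

/-- Passing to the difference quotient costs one derivative and gains the factor `1 / (m + 2)`, the
integral of `s ^ (m + 1)` over `[0, 1]`. This drives the induction on the order of differentiation.
-/
lemma DerivChain.slopeChain (h : DerivChain (m + 1) L g) (t₀ : ℝ) :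
    DerivChain m (L / (m + 2)) (slopeChain g t₀) where
  hasDerivAt i hi x := by
    have hc := h.continuous (i := i + 1) (by omega)
    have hc' := h.continuous (i := i + 2) (by omega)
    obtain ⟨C, hC⟩ := (isCompact_closedBall t₀ (|x - t₀| + 1)).exists_bound_of_continuousOn
      hc'.continuousOn
    refine (intervalIntegral.hasDerivAt_integral_of_dominated_loc_of_deriv_le (μ := volume)
      (F := fun x s => s ^ i * g (i + 1) (t₀ + s * (x - t₀)))
      (F' := fun x s => s ^ (i + 1) * g (i + 1 + 1) (t₀ + s * (x - t₀)))
      (bound := fun _ => C) (Metric.ball_mem_nhds x one_pos) ?_ ?_ ?_ ?_ ?_ ?_).2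
    · exact Filter.Eventually.of_forall fun y => (by fun_prop : Continuous _).aestronglyMeasurable
    · exact (by fun_prop : Continuous _).intervalIntegrable _ _
    · exact (by fun_prop : Continuous _).aestronglyMeasurable
    · refine Filter.Eventually.of_forall fun s hs y hy => ?_
      rw [uIoc_of_le zero_le_one] at hs
      have hs0 := hs.1.le
      have h1 : ‖s ^ (i + 1)‖ ≤ 1 := by
        rw [Real.norm_eq_abs, abs_of_nonneg (by positivity)]
        exact pow_le_one₀ hs0 hs.2
      have h2 : ‖g (i + 2) (t₀ + s * (y - t₀))‖ ≤ C := by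
        refine hC _ ?_
        rw [Metric.mem_closedBall, Real.dist_eq, add_sub_cancel_left, abs_mul, abs_of_nonneg hs0]
        rw [Metric.mem_ball, Real.dist_eq] at hy
        have h3 : |y - t₀| ≤ |x - t₀| + 1 := by
          have := abs_sub_le y x t₀
          linarith
        nlinarith [abs_nonneg (y - t₀), hs.2]
      rw [norm_mul]
      nlinarith [norm_nonneg (g (i + 2) (t₀ + s * (y - t₀))), norm_nonneg (s ^ (i + 1))]
    · exact intervalIntegrable_const
    · refine Filter.Eventually.of_forall fun s _ y _ => ?_
      have hin : HasDerivAt (fun y : ℝ => t₀ + s * (y - t₀)) s y := by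
        simpa using (((hasDerivAt_id y).sub_const t₀).const_mul s).const_add t₀
      have := ((h.hasDerivAt (i + 1) (by omega) _).comp y hin).const_mul (s ^ i)
      refine this.congr_deriv ?_
      ring
  lip x y := by
    have hc := h.continuous (i := m + 1) le_rfl
    have hint : ∀ z, IntervalIntegrable (fun s => s ^ m * g (m + 1) (t₀ + s * (z - t₀)))
        volume 0 1 := fun z => Continuous.intervalIntegrable (by fun_prop) _ _
    rw [IRED.slopeChain, IRED.slopeChain, ← intervalIntegral.integral_sub (hint x) (hint y),
      ← Real.norm_eq_abs]
    have hb : ∀ s ∈ Icc (0 : ℝ) 1, ‖s ^ m * g (m + 1) (t₀ + s * (x - t₀)) -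
        s ^ m * g (m + 1) (t₀ + s * (y - t₀))‖ ≤ s ^ (m + 1) * (L * |x - y|) := by
      intro s hs
      have h1 := h.lip (t₀ + s * (x - t₀)) (t₀ + s * (y - t₀))
      rw [show t₀ + s * (x - t₀) - (t₀ + s * (y - t₀)) = s * (x - y) by ring, abs_mul,
        abs_of_nonneg hs.1] at h1
      have h0 : 0 ≤ s ^ m := pow_nonneg hs.1 m
      rw [← mul_sub, norm_mul, Real.norm_eq_abs, abs_of_nonneg h0]
      calc _ ≤ s ^ m * (L * (s * |x - y|)) := by
            rw [Real.norm_eq_abs]; gcongr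
        _ = _ := by ring
    refine (intervalIntegral.norm_integral_le_of_norm_le zero_le_one
      (Filter.Eventually.of_forall fun s hs => hb s (Ioc_subset_Icc_self hs))
      (Continuous.intervalIntegrable (by fun_prop) _ _)).trans_eq ?_
    rw [intervalIntegral.integral_mul_const, integral_pow]
    push_cast
    simp
    ring

end Slope

lemma succ_mul_c (i j : ℕ) :
    ((j : ℝ) + 1) * c (i + 1) (j + 1) = j * c (i + 1) j + (i + 1) * c i j := by
  rw [c]
  field_simp

lemma c_nonneg : ∀ i j, 0 ≤ c i j
  | 0, 0 => by simp [c]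
  | 0, _ + 1 => by simp [c]
  | _ + 1, 0 => by simp [c]
  | i + 1, j + 1 => by
    have h1 := c_nonneg (i + 1) j
    have h2 := c_nonneg i j
    rw [c]
    positivity

lemma c_eq_zero : ∀ i j, j < i → c i j = 0
  | 0, _, h => by omega
  | _ + 1, 0, _ => by simp [c]
  | i + 1, j + 1, h => by
    rw [c, c_eq_zero (i + 1) j (by omega), c_eq_zero i j (by omega)]
    simp

lemma c_self_pos : ∀ i, 0 < c i i
  | 0 => by simp [c]
  | i + 1 => by
    have := c_self_pos i
    rw [c, c_eq_zero (i + 1) i (by omega)]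
    positivity

lemma c_pos {i j : ℕ} (hi : 1 ≤ i) (hij : i ≤ j) : 0 < c i j := by
  induction j, hij using Nat.le_induction with
  | base => exact c_self_pos i
  | succ j hij ih =>
    obtain ⟨i, rfl⟩ : ∃ k, i = k + 1 := ⟨i - 1, by omega⟩
    have h2 := c_nonneg i j
    have hj : (0 : ℝ) < j := by exact_mod_cast (by omega : 0 < j)
    rw [c]
    positivity

/-- Error bound for numerical differentiation by backward differences. -/
theorem DerivChain.abs_sub_sum_le {T : ℝ} (hT : 0 < T) (t : ℝ) (i : ℕ) : ∀ {m : ℕ} {L : ℝ}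
    {g : ℕ → ℝ → ℝ}, i ≤ m → DerivChain m L g →
    |T ^ i * g i t - ∑ j ∈ Finset.range (m + 1), c i j * (IRED.bdiff T)^[j] (g 0) t| ≤
      c i (m + 1) * L * T ^ (m + 1) := by
  induction i with
  | zero =>
    intro m L g _ h
    rw [Finset.sum_range_succ', Finset.sum_eq_zero (fun j _ => by simp [c])]
    simp [c]
  | succ i ih =>
    intro m L g hi h
    obtain ⟨n, rfl⟩ : ∃ n, m = n + 1 := ⟨m - 1, by omega⟩
    set b : ℕ → ℝ := fun j => (IRED.bdiff T)^[j] (IRED.slopeChain g t 0) t with hb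
    have hslope := h.slopeChain t
    have h1 := ih (by omega) hslope
    have h2 : |b (n + 1)| ≤ L / (n + 2) * T ^ (n + 1) := hslope.abs_iterate_bdiff_le hT.le t
    -- By the recursion of `c`, each summand is one from the induction hypothesis for the difference
    -- quotient plus a telescoping term; only the boundary term with `b (n + 1)` survives.
    have hterm : ∀ j, c (i + 1) (j + 1) * (IRED.bdiff T)^[j + 1] (g 0) t =
        T * ((i + 1) * (c i j * b j)) +
        T * (j * c (i + 1) j * b j - ((j + 1 : ℕ) : ℝ) * c (i + 1) (j + 1) * b (j + 1)) := by
      intro j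
      have e1 : (IRED.bdiff T)^[j + 1] (g 0) t =
          (j + 1) * T * (IRED.bdiff T)^[j] (IRED.slopeChain g t 0) (t - T) := by
        rw [← iterate_bdiff_sub_const T (g 0 t)]
        simp only [h.sub_eq_mul_slopeChain t]
        rw [iterate_bdiff_mul]
        ring
      have e2 : b (j + 1) = b j - (IRED.bdiff T)^[j] (IRED.slopeChain g t 0) (t - T) := by
        simp only [hb]
        rw [Function.iterate_succ_apply', IRED.bdiff]
      rw [e1, show (IRED.bdiff T)^[j] (IRED.slopeChain g t 0) (t - T) = b j - b (j + 1) by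
        rw [e2]; ring]
      push_cast
      linear_combination (T * b j) * succ_mul_c i j
    rw [Finset.sum_range_succ', Finset.sum_congr rfl (fun j _ => hterm j), Finset.sum_add_distrib,
      ← Finset.mul_sum, ← Finset.mul_sum, ← Finset.mul_sum,
      Finset.sum_range_sub' (fun j : ℕ => (j : ℝ) * c (i + 1) j * b j)]
    have e3 := slopeChain_self g t i
    have e4 : T ^ (i + 1) * g (i + 1) t - (T * ((i + 1) * ∑ j ∈ Finset.range (n + 1), c i j * b j)
        + T * (((0 : ℕ) : ℝ) * c (i + 1) 0 * b 0 - ((n + 1 : ℕ) : ℝ) * c (i + 1) (n + 1) * b (n + 1))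
        + c (i + 1) 0 * (IRED.bdiff T)^[0] (g 0) t) =
        T * (i + 1) * (T ^ i * IRED.slopeChain g t i t -
          ∑ j ∈ Finset.range (n + 1), c i j * b j) +
        T * (n + 1) * c (i + 1) (n + 1) * b (n + 1) := by
      rw [← e3]
      simp only [c]
      push_cast
      ring
    rw [e4]
    have hc1 := c_nonneg i (n + 1)
    have hc2 := c_nonneg (i + 1) (n + 1)
    calc _ ≤ T * (i + 1) * |T ^ i * IRED.slopeChain g t i t -
          ∑ j ∈ Finset.range (n + 1), c i j * b j| + T * (n + 1) * c (i + 1) (n + 1) * |b (n + 1)| := by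
          refine (abs_add_le _ _).trans_eq ?_
          rw [abs_mul, abs_mul (T * (n + 1) * c (i + 1) (n + 1)), abs_of_nonneg (by positivity),
            abs_of_nonneg (a := T * (n + 1) * c (i + 1) (n + 1)) (by positivity)]
      _ ≤ T * (i + 1) * (c i (n + 1) * (L / (n + 2)) * T ^ (n + 1)) +
          T * (n + 1) * c (i + 1) (n + 1) * (L / (n + 2) * T ^ (n + 1)) := by gcongr
      _ = _ := by
        -- The two error contributions add up by the recursion of `c` once more.
        have := succ_mul_c i (n + 1)
        push_cast at this
        rw [show (n : ℝ) + 1 + 1 = n + 2 by ring] at this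
        have hn : (n : ℝ) + 2 ≠ 0 := by positivity
        field_simp
        linear_combination (-(T : ℝ) ^ (n + 2) * L) * this

/-! ### Extension of signals to the real line. -/

/-- A Lipschitz function is absolutely continuous, hence the integral of its derivative; this
replaces the unknown constant `C` by the almost-everywhere bound `L`. -/
lemma abs_sub_le_of_ae_abs_derivWithin_le {F : ℝ → ℝ} {C : NNReal} {L : ℝ}
    (hF : LipschitzOnWith C F (Ici 0))
    (hL : ∀ᵐ t ∂(volume.restrict (Ici (0 : ℝ))), |derivWithin F (Ici 0) t| ≤ L) {s t : ℝ}
    (hs : 0 ≤ s) (ht : 0 ≤ t) : |F s - F t| ≤ L * |s - t| := by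
  have hsub : uIcc t s ⊆ Ici 0 := by
    intro x hx
    exact (le_min ht hs).trans hx.1
  have hac := (hF.mono hsub).absolutelyContinuousOnInterval
  rw [← hac.integral_deriv_eq_sub, ← Real.norm_eq_abs]
  refine intervalIntegral.norm_integral_le_of_norm_le_const_ae ?_
  rw [ae_restrict_iff' measurableSet_Ici] at hL
  filter_upwards [hL] with x hx hxm
  have hx0 : 0 < x := (le_min ht hs).trans_lt hxm.1
  rw [← derivWithin_of_mem_nhds (Ici_mem_nhds hx0)]
  exact hx hx0.le

/-- The `i`th derivative of the Taylor polynomial of degree `m` with derivatives `v` at `0`. -/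
def taylorPoly (m : ℕ) (v : ℕ → ℝ) (i : ℕ) (t : ℝ) : ℝ :=
  ∑ j ∈ Finset.range (m + 1 - i), v (i + j) * (t ^ j / (j.factorial : ℝ))

lemma taylorPoly_zero {m i : ℕ} (hi : i ≤ m) (v : ℕ → ℝ) : taylorPoly m v i 0 = v i := by
  obtain ⟨n, hn⟩ : ∃ n, m + 1 - i = n + 1 := ⟨m - i, by omega⟩
  rw [taylorPoly, hn, Finset.sum_range_succ', Finset.sum_eq_zero (fun j _ => by simp)]
  simp

lemma hasDerivAt_taylorPoly {m i : ℕ} (hi : i < m) (v : ℕ → ℝ) (t : ℝ) :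
    HasDerivAt (taylorPoly m v i) (taylorPoly m v (i + 1) t) t := by
  obtain ⟨n, hn⟩ : ∃ n, m + 1 - i = n + 1 := ⟨m - i, by omega⟩
  have hn' : m + 1 - (i + 1) = n := by omega
  have h : HasDerivAt (fun t : ℝ => ∑ j ∈ Finset.range (n + 1),
      v (i + j) * (t ^ j / (j.factorial : ℝ)))
      (∑ j ∈ Finset.range (n + 1), v (i + j) * ((j : ℝ) * t ^ (j - 1) / (j.factorial : ℝ))) t :=
    HasDerivAt.fun_sum fun j _ => ((hasDerivAt_pow j t).div_const _).const_mul _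
  rw [Finset.sum_range_succ'] at h
  unfold taylorPoly
  rw [hn, hn']
  refine h.congr_deriv ?_
  simp only [Nat.cast_zero, zero_mul, zero_div, mul_zero, add_zero]
  refine Finset.sum_congr rfl fun j _ => ?_
  have : (j.factorial : ℝ) ≠ 0 := by exact_mod_cast j.factorial_ne_zero
  rw [Nat.factorial_succ, Nat.add_sub_cancel, show i + (j + 1) = i + 1 + j by ring]
  push_cast
  field_simp

/-- The extension of a signal and its derivatives to the real line by the Taylor polynomial. -/
def extension (m : ℕ) (v : ℕ → ℝ) (f : ℝ → ℝ) (i : ℕ) (t : ℝ) : ℝ :=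
  if 0 ≤ t then sigDeriv i f t else taylorPoly m v i t

lemma extension_of_nonneg (m : ℕ) (v : ℕ → ℝ) (f : ℝ → ℝ) (i : ℕ) {t : ℝ} (ht : 0 ≤ t) :
    extension m v f i t = sigDeriv i f t := if_pos ht

lemma extension_of_nonpos {m : ℕ} {v : ℕ → ℝ} {f : ℝ → ℝ} (hv : ∀ i ≤ m, sigDeriv i f 0 = v i)
    {i : ℕ} (hi : i ≤ m) {t : ℝ} (ht : t ≤ 0) : extension m v f i t = taylorPoly m v i t := by
  rcases ht.eq_or_lt with rfl | h
  · rw [extension_of_nonneg _ _ _ _ le_rfl, hv i hi, taylorPoly_zero hi]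
  · exact if_neg (not_le.2 h)

lemma derivChain_extension {m : ℕ} {L : ℝ} (hL : 0 ≤ L) {v : ℕ → ℝ} {f : ℝ → ℝ}
    (hf : f ∈ signals m L) (hv : ∀ i ≤ m, sigDeriv i f 0 = v i) :
    DerivChain m L (extension m v f) where
  hasDerivAt i hi t := by
    have hr : ∀ t, 0 ≤ t →
        HasDerivWithinAt (extension m v f i) (extension m v f (i + 1) t) (Ici 0) t := by
      intro t ht
      rw [extension_of_nonneg _ _ _ _ ht]
      refine HasDerivWithinAt.congr_of_mem (f := sigDeriv i f) ?_
        (fun x hx => extension_of_nonneg _ _ _ _ hx) ht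
      have := (hf.1 i hi t ht).hasDerivWithinAt
      rwa [sigDeriv, iteratedDerivWithin_succ]
    have hl : ∀ t, t ≤ 0 →
        HasDerivWithinAt (extension m v f i) (extension m v f (i + 1) t) (Iic 0) t := by
      intro t ht
      rw [extension_of_nonpos hv (by omega) ht]
      exact HasDerivWithinAt.congr_of_mem (hasDerivAt_taylorPoly hi v t).hasDerivWithinAt
        (fun x hx => extension_of_nonpos hv (by omega) hx) ht
    rcases lt_trichotomy t 0 with h | rfl | h
    · exact (hl t h.le).hasDerivAt (Iic_mem_nhds h)
    · have := (hl 0 le_rfl).union (hr 0 le_rfl)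
      rwa [Iic_union_Ici, hasDerivWithinAt_univ] at this
    · exact (hr t h.le).hasDerivAt (Ici_mem_nhds h)
  lip s t := by
    obtain ⟨-, ⟨C, hC⟩, hae⟩ := hf
    -- The `m`th derivative of the Taylor polynomial is constant, so the extension is the signal's
    -- derivative composed with the nonexpansive map `max t 0`.
    have key : ∀ t, extension m v f m t = sigDeriv m f (max t 0) := by
      intro t
      rcases le_total 0 t with h | h
      · rw [extension_of_nonneg _ _ _ _ h, max_eq_left h]
      · rw [extension_of_nonpos hv le_rfl h, max_eq_right h, hv m le_rfl]
        simp [taylorPoly]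
    have hae' : ∀ᵐ t ∂(volume.restrict (Ici (0 : ℝ))),
        |derivWithin (sigDeriv m f) (Ici 0) t| ≤ L := by
      filter_upwards [hae] with x hx
      rwa [sigDeriv, iteratedDerivWithin_succ] at hx
    rw [key, key]
    refine (abs_sub_le_of_ae_abs_derivWithin_le hC hae' (le_max_right _ _)
      (le_max_right _ _)).trans ?_
    exact mul_le_mul_of_nonneg_left (abs_max_sub_max_le_abs s t 0) hL

/-! ### Error trajectories, ultimate bounds and sliding mode. -/

/-- Trajectories `e` of the estimation error: `σ k` is the argument of the signed powers, `η` the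
noise, `δ` the disturbance and `s k` the selection from the set-valued sign. -/
structure ErrorTraj (m : ℕ) (L T : ℝ) (lam : ℕ → ℝ) (N : ℝ) (e : ℕ → ℕ → ℝ)
    (σ η δ s : ℕ → ℝ) : Prop where
  zero : ∀ k, 1 ≤ k → e (k + 1) 0 = σ k - η k
  step : ∀ k, 1 ≤ k → ∀ i < m, e (k + 1) i = e k i
    - T * lam (i + 1) * L ^ (((i : ℝ) + 1) / ((m : ℝ) + 1))
      * spow (σ k) (((m : ℝ) - i) / ((m : ℝ) + 1)) + T * e (k + 1) (i + 1)
  last : ∀ k, 1 ≤ k → e (k + 1) m = e k m + T * (δ k - lam (m + 1) * L * s k)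
  sign : ∀ k, 1 ≤ k → s k ∈ signSet (σ k)
  dist_le : ∀ k, 1 ≤ k → |δ k| ≤ L
  noise_le : ∀ k, |η k| ≤ N

/-- The error variables in reversed order, scaled by `L` and the parameters. -/
def normalize (m : ℕ) (L : ℝ) (lam : ℕ → ℝ) (e : ℕ → ℝ) (p : ℕ) : ℝ :=
  e (m + 1 - p) / (L * lam (m + 1 - p))

/-- The size `γ_{m+1} (N / (2L))^(1/(m+1))` of the error, in homogeneous units, that remains under
noise bounded by `N`. -/
def noiseLevel (m : ℕ) (L : ℝ) (a : ℕ → ℝ) (N : ℝ) : ℝ :=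
  γ a (m + 1) * (N / (2 * L)) ^ (1 / ((m : ℝ) + 1))

/-- The error bounds attained in finite time under noise bounded by `N`. -/
def ErrorBound (m : ℕ) (L : ℝ) (a lam : ℕ → ℝ) (N : ℝ) (e : ℕ → ℝ) : Prop :=
  ∀ j ≤ m, |e j| ≤ L * lam j * (β a (m + 1 - j) * noiseLevel m L a N) ^ (m + 1 - j)

lemma eq_sum_of_backward {m : ℕ} {T : ℝ} {A b : ℕ → ℝ} (h : ∀ i < m, A i = b i + T * A (i + 1)) :
    A 0 = ∑ i ∈ Finset.range m, T ^ i * b i + T ^ m * A m := by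
  induction m with
  | zero => simp
  | succ m ih =>
    rw [ih fun i hi => h i (by omega), Finset.sum_range_succ, h m (by omega)]
    ring

lemma sum_half_pow (n : ℕ) : ∑ j ∈ Finset.range n, (1 / 2 : ℝ) ^ (n - j) = 1 - (1 / 2) ^ n := by
  induction n with
  | zero => simp
  | succ n ih =>
    rw [Finset.sum_range_succ, Finset.sum_congr rfl (g := fun j => (1 / 2 : ℝ) ^ (n - j) * (1 / 2))
      (fun j hj => by
        rw [Nat.succ_sub (Finset.mem_range.1 hj).le, pow_succ]),
      ← Finset.sum_mul, ih]
    simp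
    ring

section

variable {m : ℕ} {L T : ℝ} {a lam : ℕ → ℝ} {N : ℝ} {e : ℕ → ℕ → ℝ} {σ η δ s : ℕ → ℝ}

/-- Homogeneity: the exponents of `L` from the gain and from rescaling `σ` add up to 1, so `L`
cancels. -/
lemma ErrorTraj.errorStep (h : ErrorTraj m L T lam N e σ η δ s) (hL : 0 < L)
    (hlam : ∀ i ≤ m + 1, 0 < lam i) {k : ℕ} (hk : 1 ≤ k) :
    ErrorStep m T (1 / lam (m + 1)) (fun p => lam (m + 2 - p) / lam (m + 1 - p))
      (normalize m L lam (e k)) (normalize m L lam (e (k + 1))) (σ k / L) where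
  one := by
    have h1 := hlam (m + 1) le_rfl
    have h2 := hlam m (by omega)
    refine ⟨s k, ?_, δ k / (L * lam (m + 1)), ?_, ?_⟩
    · have hs := h.sign k hk
      constructor
      · intro hne
        have hne' : σ k ≠ 0 := fun h0 => hne (by simp [h0])
        rw [hs.1 hne']
        rcases lt_or_gt_of_ne hne' with h0 | h0
        · rw [Real.sign_of_neg h0, Real.sign_of_neg (div_neg_of_neg_of_pos h0 hL)]
        · rw [Real.sign_of_pos h0, Real.sign_of_pos (div_pos h0 hL)]
      · intro h0
        exact hs.2 ((div_eq_zero_iff.1 h0).resolve_right hL.ne')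
    · rw [abs_div, abs_of_pos (mul_pos hL h1), div_le_div_iff₀ (by positivity) h1]
      nlinarith [h.dist_le k hk]
    · simp only [normalize, Nat.add_sub_cancel, show m + 2 - 1 = m + 1 by omega]
      rw [h.last k hk]
      field_simp
  succ p h1 hp := by
    obtain ⟨i, rfl⟩ : ∃ i, m = i + p := ⟨m - p, by omega⟩
    have h2 := hlam i (by omega)
    have h3 := hlam (i + 1) (by omega)
    have hp0 : (0 : ℝ) < p := by exact_mod_cast h1
    have hs := h.step k hk i (by omega)
    simp only [normalize, show i + p + 1 - (p + 1) = i by omega,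
      show i + p + 2 - (p + 1) = i + 1 by omega, show i + p + 1 - p = i + 1 by omega]
    have e1 : spow (σ k) ((((i + p : ℕ) : ℝ) - i) / (((i + p : ℕ) : ℝ) + 1)) =
        L ^ ((p : ℝ) / (((i + p : ℕ) : ℝ) + 1)) *
          spow (σ k / L) ((p : ℝ) / (((i + p : ℕ) : ℝ) + 1)) := by
      rw [← spow_mul_left hL (by positivity), mul_div_cancel₀ _ hL.ne']
      congr 1
      push_cast
      ring
    have e2 : L ^ (((i : ℝ) + 1) / (((i + p : ℕ) : ℝ) + 1)) *
        L ^ ((p : ℝ) / (((i + p : ℕ) : ℝ) + 1)) = L := by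
      rw [← Real.rpow_add hL, ← add_div]
      push_cast
      rw [show (i : ℝ) + 1 + p = i + p + 1 by ring, div_self (by positivity), Real.rpow_one]
    rw [hs, e1]
    generalize L ^ (((i : ℝ) + 1) / (((i + p : ℕ) : ℝ) + 1)) = A at e2 ⊢
    generalize L ^ ((p : ℝ) / (((i + p : ℕ) : ℝ) + 1)) = B at e2 ⊢
    generalize spow (σ k / L) ((p : ℝ) / (((i + p : ℕ) : ℝ) + 1)) = C
    rw [show T * lam (i + 1) * A * (B * C) = T * lam (i + 1) * (A * B) * C by ring, e2]
    field_simp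
    ring

lemma noiseLevel_nonneg (ha : ∀ j ∈ Finset.Icc 1 m, a j ∈ Ioo (1 : ℝ) 2) (hL : 0 < L)
    (hN : 0 ≤ N) : 0 ≤ noiseLevel m L a N := by
  have := γ_pos ha (p := m + 1) le_rfl
  unfold noiseLevel
  positivity

lemma exists_errorBound_of_pos (ha : ∀ j ∈ Finset.Icc 1 m, a j ∈ Ioo (1 : ℝ) 2) (hL : 0 < L)
    (hT : 0 < T) (hlam0 : lam 0 = 1) (hlam : ∀ i ≤ m + 1, 0 < lam i) (hlam1 : 1 < lam (m + 1))
    (hcond : ∀ j ∈ Finset.Icc 1 m,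
      lam (m - j + 2) / lam (m - j + 1) * μ a j < lam (m - j + 1) / lam (m - j))
    (e₁ : ℕ → ℝ) (hN : 0 < N) :
    ∃ K : ℕ, 1 ≤ K ∧ ∀ e σ η δ s, ErrorTraj m L T lam N e σ η δ s → e 1 = e₁ →
      ∀ k, K ≤ k → ErrorBound m L a lam N (e k) := by
  have hγ := γ_pos ha (p := m + 1) le_rfl
  have hM : 0 < noiseLevel m L a N := by unfold noiseLevel; positivity
  obtain ⟨K, hK, h⟩ := exists_lyap_le (T := T) (ρ := 1 / lam (m + 1))
    (κ := fun p => lam (m + 2 - p) / lam (m + 1 - p)) ha hT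
    (fun p _ _ => div_pos (hlam _ (by omega)) (hlam _ (by omega)))
    (by rw [div_lt_one (by linarith)]; exact hlam1)
    (fun p h1 hp => by
      have := hcond p (Finset.mem_Icc.2 ⟨h1, hp⟩)
      rw [show m - p + 2 = m + 2 - p by omega, show m - p + 1 = m + 1 - p by omega,
        show m - p = m + 1 - (p + 1) by omega] at this
      simpa only [show m + 2 - (p + 1) = m + 1 - p by omega] using this)
    (lyap m a (normalize m L lam e₁)) hM
  refine ⟨K, hK, fun e σ η δ s ht he k hk j hj => ?_⟩
  have hly := h (fun k => normalize m L lam (e k)) (fun k => σ k / L) (by simp only [he]; rfl)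
    (fun k hk => ht.errorStep hL hlam hk) (fun k hk => ?_) k hk
  · have h1 := (inLevel_of_lyap_le ha hly).abs_le ha (p := m + 1 - j) (by omega) (by omega)
    have hl := hlam j (by omega)
    rw [normalize, show m + 1 - (m + 1 - j) = j by omega, abs_div,
      abs_of_pos (mul_pos hL hl), div_le_iff₀ (mul_pos hL hl)] at h1
    linarith
  -- `noiseLevel` is the level at which the admissible perturbation is exactly `N / L`.
  · have h1 : (noiseLevel m L a N / γ a (m + 1)) ^ (m + 1) = N / (2 * L) := by
      have := Real.rpow_inv_natCast_pow (show 0 ≤ N / (2 * L) by positivity) m.succ_ne_zero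
      rw [noiseLevel, mul_div_cancel_left₀ _ hγ.ne', one_div]
      rw [← Nat.cast_succ]
      exact this
    simp only [normalize, Nat.sub_self, hlam0, h1, ht.zero k hk]
    rw [mul_one, ← sub_div, sub_sub_cancel, abs_div, abs_of_pos hL]
    have := ht.noise_le k
    field_simp
    linarith

/-- The scalar equation determining the argument of the signed powers. -/
lemma ErrorTraj.scalar_eq (h : ErrorTraj m L T lam N e σ η δ s) {k : ℕ} (hk : 1 ≤ k) :
    σ k + ∑ i ∈ Finset.range m, T ^ i * (T * lam (i + 1) * L ^ (((i : ℝ) + 1) / ((m : ℝ) + 1))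
        * spow (σ k) (((m : ℝ) - i) / ((m : ℝ) + 1))) + T ^ (m + 1) * lam (m + 1) * L * s k =
      η k + ∑ i ∈ Finset.range (m + 1), T ^ i * e k i + T ^ (m + 1) * δ k := by
  have h1 := eq_sum_of_backward (h.step k hk)
  simp only [mul_sub, Finset.sum_sub_distrib] at h1
  rw [h.zero k hk, h.last k hk] at h1
  rw [Finset.sum_range_succ]
  linear_combination h1

/-- For `y ≠ 0` every term on the left has the sign of `y`, and the total exceeds `B` in absolute
value. -/
lemma eq_zero_of_scalar_eq (hL : 0 < L) (hT : 0 < T) (hlam : ∀ i ≤ m + 1, 0 < lam i)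
    {y B t r : ℝ} (ht : t ∈ signSet y) (heq : y + ∑ i ∈ Finset.range m,
      T ^ i * (T * lam (i + 1) * L ^ (((i : ℝ) + 1) / ((m : ℝ) + 1))
        * spow y (((m : ℝ) - i) / ((m : ℝ) + 1))) + B * t = r) (hr : |r| ≤ B) : y = 0 := by
  obtain ⟨hr1, hr2⟩ := abs_le.1 hr
  have hexp : ∀ i ∈ Finset.range m, 0 < ((m : ℝ) - i) / ((m : ℝ) + 1) := fun i hi =>
    div_pos (sub_pos.2 (by exact_mod_cast Finset.mem_range.1 hi)) (by positivity)
  have hco : ∀ i ∈ Finset.range m,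
      0 ≤ T * lam (i + 1) * L ^ (((i : ℝ) + 1) / ((m : ℝ) + 1)) := fun i hi => by
    have := hlam (i + 1) (by have := Finset.mem_range.1 hi; omega)
    positivity
  rcases lt_trichotomy y 0 with h0 | h0 | h0
  · have : ∑ i ∈ Finset.range m, T ^ i * (T * lam (i + 1) * L ^ (((i : ℝ) + 1) / ((m : ℝ) + 1))
        * spow y (((m : ℝ) - i) / ((m : ℝ) + 1))) ≤ 0 := Finset.sum_nonpos fun i hi =>
      mul_nonpos_of_nonneg_of_nonpos (by positivity)
        (mul_nonpos_of_nonneg_of_nonpos (hco i hi) (spow_nonpos (hexp i hi) h0.le))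
    rw [signSet_of_neg h0 ht] at heq
    linarith
  · exact h0
  · have : 0 ≤ ∑ i ∈ Finset.range m, T ^ i * (T * lam (i + 1) * L ^ (((i : ℝ) + 1) / ((m : ℝ) + 1))
        * spow y (((m : ℝ) - i) / ((m : ℝ) + 1))) := Finset.sum_nonneg fun i hi =>
      mul_nonneg (by positivity) (mul_nonneg (hco i hi) (spow_nonneg (hexp i hi) h0.le))
    rw [signSet_of_pos h0 ht] at heq
    linarith

lemma Nbar_pos (ha : ∀ j ∈ Finset.Icc 1 m, a j ∈ Ioo (1 : ℝ) 2) (hL : 0 < L) (hT : 0 < T)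
    (hlam : ∀ i ≤ m + 1, 0 < lam i) (hlam1 : 1 < lam (m + 1)) : 0 < Nbar m L T a lam := by
  rw [Nbar, Finset.lt_inf'_iff]
  intro p hp
  have hp := Finset.mem_range.1 hp
  have h1 := γ_pos ha (p := m + 1) le_rfl
  have h2 := β_pos ha (p := m + 1 - p) (by omega)
  have h3 := hlam p (by omega)
  have h4 := sub_pos.2 hlam1
  positivity

/-- The term of `Nbar` with index `j` is what makes the `j`th error bound at most this share; the
powers of 1/2 are later summed over `j`. -/
lemma mul_noiseLevel_pow_le (ha : ∀ j ∈ Finset.Icc 1 m, a j ∈ Ioo (1 : ℝ) 2) (hL : 0 < L)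
    (hT : 0 < T) (hlam : ∀ i ≤ m + 1, 0 < lam i) (hlam1 : 1 < lam (m + 1)) (hN : 0 ≤ N)
    (hNbar : N ≤ Nbar m L T a lam) {j : ℕ} (hj : j ≤ m) :
    lam j * (β a (m + 1 - j) * noiseLevel m L a N) ^ (m + 1 - j) ≤
      (T / 2) ^ (m + 1 - j) * (lam (m + 1) - 1) := by
  have h1 := γ_pos ha (p := m + 1) le_rfl
  have h2 := β_pos ha (p := m + 1 - j) (by omega)
  have h3 := hlam j (by omega)
  have h4 := sub_pos.2 hlam1
  have h5 := hNbar.trans (Finset.inf'_le _ (Finset.mem_range.2 (by omega : j < m + 1)))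
  set q := m + 1 - j with hq
  have hq0 : q ≠ 0 := by omega
  set Y := (lam (m + 1) - 1) / lam j with hY
  have hY0 : 0 < Y := by positivity
  have h6 : N / (2 * L) ≤ (T / 2 / (β a q * γ a (m + 1)) * Y ^ (1 / (q : ℝ))) ^ (m + 1) := by
    rw [mul_pow, div_pow, div_pow, mul_pow, ← Real.rpow_natCast (Y ^ (1 / (q : ℝ))),
      ← Real.rpow_mul hY0.le, div_le_iff₀ (by positivity)]
    refine h5.trans_eq ?_
    rw [show (1 / (q : ℝ)) * ((m + 1 : ℕ) : ℝ) = ((m : ℝ) + 1) / q by push_cast; ring]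
    generalize Y ^ (((m : ℝ) + 1) / (q : ℝ)) = A
    rw [pow_succ (2 : ℝ) m]
    field_simp
  have h7 : (N / (2 * L)) ^ (1 / ((m : ℝ) + 1)) ≤
      T / 2 / (β a q * γ a (m + 1)) * Y ^ (1 / (q : ℝ)) := by
    refine (Real.rpow_le_rpow (by positivity) h6 (by positivity)).trans_eq ?_
    have := Real.pow_rpow_inv_natCast (n := m + 1)
      (x := T / 2 / (β a q * γ a (m + 1)) * Y ^ (1 / (q : ℝ))) (by positivity) (by omega)
    rwa [Nat.cast_succ, ← one_div] at this
  have h8 : β a q * noiseLevel m L a N ≤ T / 2 * Y ^ (1 / (q : ℝ)) := by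
    rw [noiseLevel]
    calc _ ≤ β a q * (γ a (m + 1) * (T / 2 / (β a q * γ a (m + 1)) * Y ^ (1 / (q : ℝ)))) := by
          gcongr
      _ = _ := by field_simp
  have h9 := noiseLevel_nonneg ha hL hN
  calc _ ≤ lam j * (T / 2 * Y ^ (1 / (q : ℝ))) ^ q := by gcongr
    _ = lam j * ((T / 2) ^ q * Y) := by
      rw [mul_pow, one_div, Real.rpow_inv_natCast_pow hY0.le hq0]
    _ = _ := by rw [hY]; field_simp

lemma le_of_le_Nbar (ha : ∀ j ∈ Finset.Icc 1 m, a j ∈ Ioo (1 : ℝ) 2) (hL : 0 < L) (hT : 0 < T)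
    (hlam0 : lam 0 = 1) (hlam1 : 1 < lam (m + 1)) (hNbar : N ≤ Nbar m L T a lam) :
    N ≤ L * T ^ (m + 1) * (lam (m + 1) - 1) * (1 / 2) ^ (m + 1) := by
  have h1 := two_le_γ ha (m + 1) le_rfl
  have h2 := one_le_β ha (m + 1) le_rfl
  have h4 := sub_pos.2 hlam1
  refine (hNbar.trans (Finset.inf'_le _ (Finset.mem_range.2 (Nat.succ_pos m)))).trans ?_
  rw [Nat.sub_zero, Nat.cast_succ, div_self (by positivity), Real.rpow_one, hlam0, div_one]
  have h5 : 2 ≤ β a (m + 1) ^ (m + 1) * γ a (m + 1) ^ (m + 1) := by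
    have h6 : 1 ≤ β a (m + 1) ^ (m + 1) := one_le_pow₀ h2
    have h7 : 2 ≤ γ a (m + 1) ^ (m + 1) := h1.trans (le_self_pow₀ (by linarith) (by omega))
    nlinarith
  have h6 : (2 : ℝ) ^ (m + 1) ≤ 2 ^ m * β a (m + 1) ^ (m + 1) * γ a (m + 1) ^ (m + 1) := by
    rw [pow_succ, mul_assoc]
    gcongr
  calc _ ≤ L * T ^ (m + 1) / 2 ^ (m + 1) * (lam (m + 1) - 1) := by gcongr
    _ = _ := by rw [one_div, inv_pow]; ring

/-- Small noise and the ultimate error bounds enforce the sliding mode. -/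
lemma ErrorTraj.sliding (h : ErrorTraj m L T lam N e σ η δ s)
    (ha : ∀ j ∈ Finset.Icc 1 m, a j ∈ Ioo (1 : ℝ) 2) (hL : 0 < L)
    (hT : 0 < T) (hlam0 : lam 0 = 1) (hlam : ∀ i ≤ m + 1, 0 < lam i) (hlam1 : 1 < lam (m + 1))
    (hN : 0 ≤ N) (hNbar : N ≤ Nbar m L T a lam) {k : ℕ} (hk : 1 ≤ k)
    (hb : ErrorBound m L a lam N (e k)) : σ k = 0 := by
  -- The allowance `L * T ^ (m + 1) * lam (m + 1)` is split: 1 part in `lam (m + 1)` for the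
  -- disturbance, and of the other `lam (m + 1) - 1` the fraction `(1 / 2) ^ (m + 1)` for the noise
  -- and the rest for the state errors.
  refine eq_zero_of_scalar_eq hL hT hlam (h.sign k hk) (h.scalar_eq hk) ?_
  have h1 : |∑ i ∈ Finset.range (m + 1), T ^ i * e k i| ≤
      L * T ^ (m + 1) * (lam (m + 1) - 1) * (1 - (1 / 2) ^ (m + 1)) := by
    rw [← sum_half_pow, Finset.mul_sum]
    refine (Finset.abs_sum_le_sum_abs _ _).trans (Finset.sum_le_sum fun j hj => ?_)
    have hj : j ≤ m := by have := Finset.mem_range.1 hj; omega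
    rw [abs_mul, abs_of_pos (by positivity : 0 < T ^ j)]
    have h2 := mul_noiseLevel_pow_le ha hL hT hlam hlam1 hN hNbar hj
    calc _ ≤ T ^ j * (L * ((T / 2) ^ (m + 1 - j) * (lam (m + 1) - 1))) := by
          gcongr
          refine (hb j hj).trans ?_
          rw [mul_assoc]
          gcongr
      _ = L * (T ^ j * T ^ (m + 1 - j)) * (lam (m + 1) - 1) * (1 / 2) ^ (m + 1 - j) := by
          rw [div_eq_mul_one_div, mul_pow]; ring
      _ = _ := by rw [← pow_add, show j + (m + 1 - j) = m + 1 by omega]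
  have h2 := le_of_le_Nbar ha hL hT hlam0 hlam1 hNbar
  have h3 : |T ^ (m + 1) * δ k| ≤ T ^ (m + 1) * L := by
    rw [abs_mul, abs_of_pos (by positivity)]
    have := h.dist_le k hk
    gcongr
  calc _ ≤ |η k| + |∑ i ∈ Finset.range (m + 1), T ^ i * e k i| + |T ^ (m + 1) * δ k| :=
        abs_add_three _ _ _
    _ ≤ _ := by linarith [h.noise_le k]

lemma ErrorTraj.mono (h : ErrorTraj m L T lam N e σ η δ s) {N' : ℝ} (hN : N ≤ N') :
    ErrorTraj m L T lam N' e σ η δ s :=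
  { h with noise_le := fun k => (h.noise_le k).trans hN }

lemma exists_errorBound (ha : ∀ j ∈ Finset.Icc 1 m, a j ∈ Ioo (1 : ℝ) 2) (hL : 0 < L)
    (hT : 0 < T) (hlam0 : lam 0 = 1) (hlam : ∀ i ≤ m + 1, 0 < lam i) (hlam1 : 1 < lam (m + 1))
    (hcond : ∀ j ∈ Finset.Icc 1 m,
      lam (m - j + 2) / lam (m - j + 1) * μ a j < lam (m - j + 1) / lam (m - j))
    (e₁ : ℕ → ℝ) (hN : 0 ≤ N) :
    ∃ K : ℕ, 1 ≤ K ∧ ∀ e σ η δ s, ErrorTraj m L T lam N e σ η δ s → e 1 = e₁ →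
      ∀ k, K ≤ k → ErrorBound m L a lam N (e k) := by
  rcases hN.eq_or_lt with rfl | hN
  · have hN' := Nbar_pos ha hL hT hlam hlam1
    obtain ⟨K, hK, h⟩ := exists_errorBound_of_pos ha hL hT hlam0 hlam hlam1 hcond e₁ hN'
    -- From time `K` on `σ = 0`, and each further step annihilates one more error coordinate, since
    -- `e (j + 1)` is a difference quotient in time of `e j`.
    refine ⟨K + m + 1, by omega, fun e σ η δ s ht he k hk j hj => ?_⟩
    have hb := h e σ η δ s (ht.mono hN'.le) he
    have hσ : ∀ k, K ≤ k → σ k = 0 := fun k hk =>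
      (ht.mono hN'.le).sliding ha hL hT hlam0 hlam hlam1 hN'.le le_rfl (hK.trans hk) (hb k hk)
    have hzero : ∀ j ≤ m, ∀ k, K + j ≤ k → e (k + 1) j = 0 := by
      intro j
      induction j with
      | zero =>
        intro _ k hk
        rw [ht.zero k (by omega), hσ k hk, abs_nonpos_iff.1 (ht.noise_le k), sub_zero]
      | succ j ih =>
        intro hj k hk
        obtain ⟨k, rfl⟩ : ∃ l, k = l + 1 := ⟨k - 1, by omega⟩
        have h1 := ht.step (k + 1) (by omega) j (by omega)
        rw [ih (by omega) (k + 1) (by omega), ih (by omega) k (by omega), hσ (k + 1) (by omega),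
          spow_zero_left, mul_zero, sub_zero, zero_add] at h1
        exact (mul_eq_zero.1 h1.symm).resolve_left hT.ne'
    obtain ⟨k, rfl⟩ : ∃ l, k = l + 1 := ⟨k - 1, by omega⟩
    rw [hzero j hj k (by omega), abs_zero]
    have h1 := hlam j (by omega)
    have h2 := β_pos ha (p := m + 1 - j) (by omega)
    have h3 := noiseLevel_nonneg (m := m) (L := L) ha hL le_rfl
    positivity
  · exact exists_errorBound_of_pos ha hL hT hlam0 hlam hlam1 hcond e₁ hN

end

/-! ### Existence of solutions. -/

/-- A state vector as a function on the natural numbers. -/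
def toSeq {m : ℕ} (z : Fin (m + 1) → ℝ) (j : ℕ) : ℝ := if h : j < m + 1 then z ⟨j, h⟩ else 0

lemma toSeq_fin {m : ℕ} (z : Fin (m + 1) → ℝ) (i : Fin (m + 1)) : toSeq z i = z i := by
  rw [toSeq, dif_pos i.2]

lemma mem_rhs_iff {m : ℕ} {L T : ℝ} {lam : ℕ → ℝ} {z z' : Fin (m + 1) → ℝ} {u : ℝ} :
    z' ∈ rhs m L T lam z z' u ↔ (∀ i < m, toSeq z' i = toSeq z i
      + T * lam (i + 1) * L ^ (((i : ℝ) + 1) / ((m : ℝ) + 1))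
          * spow (u - toSeq z' 0) (((m : ℝ) - i) / ((m : ℝ) + 1)) + T * toSeq z' (i + 1)) ∧
      ∃ s ∈ signSet (u - toSeq z' 0), toSeq z' m = toSeq z m + T * lam (m + 1) * L * s := by
  have h0 : toSeq z' 0 = z' 0 := toSeq_fin z' 0
  have hl : ∀ y : Fin (m + 1) → ℝ, toSeq y m = y (Fin.last m) := fun y => toSeq_fin y (Fin.last m)
  rw [h0, hl, hl]
  refine and_congr ⟨fun h i hi => ?_, fun h i => ?_⟩ Iff.rfl
  · have := h ⟨i, hi⟩
    rw [← toSeq_fin z' (Fin.castSucc _), ← toSeq_fin z (Fin.castSucc _),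
      ← toSeq_fin z' (Fin.succ _)] at this
    simpa using this
  · have := h i i.2
    rw [← toSeq_fin z' (Fin.castSucc _), ← toSeq_fin z (Fin.castSucc _),
      ← toSeq_fin z' (Fin.succ _)]
    simpa using this

section Existence

variable {m : ℕ} {L T : ℝ} {lam : ℕ → ℝ}

/-- By oddness `r ≥ 0` suffices. For `r ≤ B` the set-valued sign at 0 absorbs `r`; otherwise the
sign is 1 and the intermediate value theorem applies on `[0, r - B]`. -/
lemma exists_scalar_eq (hL : 0 < L) (hT : 0 < T) (hlam : ∀ i ≤ m + 1, 0 < lam i) {B : ℝ}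
    (hB : 0 < B) (r : ℝ) : ∃ y, ∃ t ∈ signSet y, y + ∑ i ∈ Finset.range m,
      T ^ i * (T * lam (i + 1) * L ^ (((i : ℝ) + 1) / ((m : ℝ) + 1))
        * spow y (((m : ℝ) - i) / ((m : ℝ) + 1))) + B * t = r := by
  wlog hr : 0 ≤ r generalizing r
  · obtain ⟨y, t, ht, h⟩ := this (-r) (by linarith)
    refine ⟨-y, -t, ⟨fun hy => ?_, fun hy => ?_⟩, ?_⟩
    · rw [Real.sign_neg, ht.1 (neg_ne_zero.1 hy)]
    · have := ht.2 (neg_eq_zero.1 hy)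
      exact ⟨by linarith [this.2], by linarith [this.1]⟩
    · simp only [spow_neg, mul_neg, Finset.sum_neg_distrib]
      linarith
  have hexp : ∀ i ∈ Finset.range m, 0 < ((m : ℝ) - i) / ((m : ℝ) + 1) := fun i hi =>
    div_pos (sub_pos.2 (by exact_mod_cast Finset.mem_range.1 hi)) (by positivity)
  by_cases hrB : r ≤ B
  · refine ⟨0, r / B, ⟨fun h => absurd rfl h, fun _ => ⟨?_, ?_⟩⟩, ?_⟩
    · have : 0 ≤ r / B := by positivity
      linarith
    · rwa [div_le_one hB]
    · simp
      field_simp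
  · push Not at hrB
    set H : ℝ → ℝ := fun y => y + ∑ i ∈ Finset.range m,
      T ^ i * (T * lam (i + 1) * L ^ (((i : ℝ) + 1) / ((m : ℝ) + 1))
        * spow y (((m : ℝ) - i) / ((m : ℝ) + 1))) with hH
    have hc : ContinuousOn H (Icc 0 (r - B)) := by
      refine continuousOn_id.add (continuousOn_finsetSum _ fun i hi => ?_)
      exact continuousOn_const.mul (continuousOn_const.mul
        ((continuousOn_spow (hexp i hi)).mono Icc_subset_Ici_self))
    have h0 : H 0 = 0 := by simp [hH]
    have h1 : r - B ≤ H (r - B) := by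
      refine le_add_of_nonneg_right (Finset.sum_nonneg fun i hi => ?_)
      have := hlam (i + 1) (by have := Finset.mem_range.1 hi; omega)
      have := spow_nonneg (hexp i hi) (sub_nonneg.2 hrB.le)
      positivity
    obtain ⟨y, hy, hyr⟩ := intermediate_value_Icc (by linarith) hc
      (show r - B ∈ Icc (H 0) (H (r - B)) from ⟨by linarith, h1⟩)
    have hy0 : y ≠ 0 := by
      rintro rfl
      linarith
    refine ⟨y, 1, ⟨fun _ => (Real.sign_of_pos (hy.1.lt_of_ne hy0.symm)).symm,
      fun h => absurd h hy0⟩, ?_⟩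
    simp only [hH] at hyr
    linarith

lemma exists_backward (m : ℕ) (T : ℝ) (b : ℕ → ℝ) (x : ℝ) :
    ∃ A : ℕ → ℝ, A m = x ∧ ∀ i < m, A i = b i + T * A (i + 1) := by
  refine ⟨fun i => Nat.rec (motive := fun _ => ℝ) x (fun n y => b (m - 1 - n) + T * y) (m - i),
    by simp, fun i hi => ?_⟩
  obtain ⟨n, rfl⟩ : ∃ n, m = i + n + 1 := ⟨m - i - 1, by omega⟩
  simp only [show i + n + 1 - i = n + 1 by omega, show i + n + 1 - (i + 1) = n by omega,
    show i + n + 1 - 1 - n = i by omega]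

/-- Once the scalar unknown `y = u - z' 0` is known, the new state follows by back-substitution from
the last coordinate, and the scalar inclusion makes it consistent with `y`. -/
lemma exists_mem_rhs (hL : 0 < L) (hT : 0 < T) (hlam : ∀ i ≤ m + 1, 0 < lam i)
    (z : Fin (m + 1) → ℝ) (u : ℝ) : ∃ z', z' ∈ rhs m L T lam z z' u := by
  have hB : 0 < T ^ (m + 1) * lam (m + 1) * L := by
    have := hlam (m + 1) le_rfl
    positivity
  obtain ⟨y, t, ht, h⟩ := exists_scalar_eq hL hT hlam hB
    (u - ∑ i ∈ Finset.range (m + 1), T ^ i * toSeq z i)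
  obtain ⟨A, hAm, hA⟩ := exists_backward m T (fun i => toSeq z i
    + T * lam (i + 1) * L ^ (((i : ℝ) + 1) / ((m : ℝ) + 1))
      * spow y (((m : ℝ) - i) / ((m : ℝ) + 1))) (toSeq z m + T * lam (m + 1) * L * t)
  have hA0 := eq_sum_of_backward hA
  simp only [mul_add (T ^ _), Finset.sum_add_distrib] at hA0
  rw [Finset.sum_range_succ] at h
  have hy : u - A 0 = y := by
    rw [hA0, hAm]
    linear_combination -h
  have hz : ∀ j ≤ m, toSeq (fun i : Fin (m + 1) => A i) j = A j := fun j hj => by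
    rw [toSeq, dif_pos (by omega)]
  refine ⟨fun i => A i, mem_rhs_iff.2 ⟨fun i hi => ?_, t, ?_, ?_⟩⟩
  · rw [hz i hi.le, hz (i + 1) hi, hz 0 (by omega), hy]
    exact hA i hi
  · rwa [hz 0 (by omega), hy]
  · rw [hz m le_rfl, hAm]

lemma exists_isSolution (hL : 0 < L) (hT : 0 < T) (hlam : ∀ i ≤ m + 1, 0 < lam i)
    (z₁ : Fin (m + 1) → ℝ) (u : ℕ → ℝ) : ∃ z, IsSolution m L T lam z₁ u z := by
  choose F hF using exists_mem_rhs (m := m) hL hT hlam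
  refine ⟨fun k => Nat.rec (motive := fun _ => Fin (m + 1) → ℝ) z₁ (fun n z => F z (u (n + 1)))
    (k - 1), rfl, fun k hk => ?_⟩
  obtain ⟨n, rfl⟩ : ∃ n, k = n + 1 := ⟨k - 1, by omega⟩
  exact hF _ _

end Existence

/-! ### From state errors to output errors. -/

section Output

variable {m : ℕ} {L T : ℝ} {a lam : ℕ → ℝ} {N : ℝ}

lemma pow_mul_output (z : ℕ → Fin (m + 1) → ℝ) (i k : ℕ) :
    T ^ i * output m T z i k =
      ∑ j ∈ Finset.range (m + 1), c i j * (T ^ j * toSeq (z (k + 1)) j) := by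
  rw [output, Finset.mul_sum, Finset.sum_range, Finset.sum_filter]
  refine Finset.sum_congr rfl fun j _ => ?_
  split_ifs with h
  · rw [toSeq_fin, show T ^ (j : ℕ) = T ^ i * T ^ ((j : ℕ) - i) by
      rw [← pow_add, Nat.add_sub_cancel' h]]
    ring
  · rw [c_eq_zero i j (by omega), zero_mul]

/-- The `p`th entry in the maximum `d` is the one that lets the error of state coordinate `m + 1 -
p` fit under the `p`th binomial term of the final bound. -/
lemma le_d_pow (ha : ∀ j ∈ Finset.Icc 1 m, a j ∈ Ioo (1 : ℝ) 2) (hL : 0 < L)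
    (hlam : ∀ i ≤ m + 1, 0 < lam i) (hN : 0 ≤ N) {i p : ℕ} (hi1 : 1 ≤ i) (him : i ≤ m)
    (hp1 : 1 ≤ p) (hp : p ≤ m - i + 1) :
    lam (m + 1 - p) * (β a p * noiseLevel m L a N) ^ p * c i (m + 1 - p) ≤
      c i (m + 1) * ((m - i + 1).choose p : ℝ) *
        (d m a lam i * (N / L) ^ (1 / ((m : ℝ) + 1))) ^ p := by
  have h1 := γ_pos ha (p := m + 1) le_rfl
  have h2 := β_pos ha (p := p) (by omega)
  have h3 := hlam (m + 1 - p) (by omega)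
  have h4 := c_pos hi1 (show i ≤ m + 1 - p by omega)
  have h5 := c_pos hi1 (show i ≤ m + 1 by omega)
  have h6 : (0 : ℝ) < ((m - i + 1).choose p : ℝ) := by exact_mod_cast Nat.choose_pos hp
  set X := lam (m + 1 - p) * c i (m + 1 - p) / (((m - i + 1).choose p : ℝ) * c i (m + 1)) with hX
  have hX0 : 0 < X := by positivity
  have hd : β a p * γ a (m + 1) / (2 : ℝ) ^ (1 / ((m : ℝ) + 1)) * X ^ (1 / (p : ℝ)) ≤
      d m a lam i :=
    Finset.le_sup' (fun p => β a p * γ a (m + 1) / (2 : ℝ) ^ (1 / ((m : ℝ) + 1)) *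
      (lam (m + 1 - p) * c i (m + 1 - p) / (((m - i + 1).choose p : ℝ) * c i (m + 1))) ^
        (1 / (p : ℝ))) (Finset.mem_Icc.2 ⟨hp1, hp⟩)
  have h7 : β a p * noiseLevel m L a N * X ^ (1 / (p : ℝ)) ≤
      d m a lam i * (N / L) ^ (1 / ((m : ℝ) + 1)) := by
    refine le_trans (le_of_eq ?_) (mul_le_mul_of_nonneg_right hd (by positivity))
    rw [noiseLevel, mul_comm 2 L, ← div_div, Real.div_rpow (by positivity) zero_le_two]
    ring
  have h8 := noiseLevel_nonneg ha hL hN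
  calc _ = c i (m + 1) * ((m - i + 1).choose p : ℝ) * ((β a p * noiseLevel m L a N) ^ p * X) := by
        rw [hX]; field_simp
    _ = c i (m + 1) * ((m - i + 1).choose p : ℝ) *
        (β a p * noiseLevel m L a N * X ^ (1 / (p : ℝ))) ^ p := by
        rw [mul_pow _ (X ^ _), one_div, Real.rpow_inv_natCast_pow hX0.le (by omega)]
    _ ≤ _ := by gcongr

lemma sum_le_of_errorBound (ha : ∀ j ∈ Finset.Icc 1 m, a j ∈ Ioo (1 : ℝ) 2) (hL : 0 < L)
    (hT : 0 < T) (hlam : ∀ i ≤ m + 1, 0 < lam i) (hN : 0 ≤ N) {e : ℕ → ℝ}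
    (he : ErrorBound m L a lam N e) {i : ℕ} (hi1 : 1 ≤ i) (him : i ≤ m) :
    ∑ j ∈ Finset.range (m + 1), c i j * (T ^ j * |e j|) + c i (m + 1) * L * T ^ (m + 1) ≤
      T ^ i * (c i (m + 1) * L *
        (T + d m a lam i * (N / L) ^ (1 / ((m : ℝ) + 1))) ^ (m - i + 1)) := by
  set D := d m a lam i * (N / L) ^ (1 / ((m : ℝ) + 1)) with hD
  set q := m - i + 1 with hq
  have hTq : T ^ i * T ^ q = T ^ (m + 1) := by rw [← pow_add]; congr 1; omega
  rw [add_comm T, add_pow, Finset.sum_range_succ' _ q, mul_add, mul_add]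
  have hsub : ∑ j ∈ Finset.range (m + 1), c i j * (T ^ j * |e j|) =
      ∑ p ∈ Finset.range q, c i (m - p) * (T ^ (m - p) * |e (m - p)|) := by
    rw [← Finset.sum_range_reflect]
    simp only [Nat.add_sub_cancel]
    refine (Finset.sum_subset (Finset.range_subset_range.2 (by omega)) fun p hp hp' => ?_).symm
    rw [Finset.mem_range] at hp hp'
    rw [c_eq_zero i _ (by omega), zero_mul]
  -- The pure power of `T` in the binomial expansion equals the truncation error; the other terms
  -- dominate the state errors one by one.
  refine add_le_add ?_ (le_of_eq ?_)
  · rw [hsub, Finset.mul_sum, Finset.mul_sum]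
    refine Finset.sum_le_sum fun p hp => ?_
    have hp := Finset.mem_range.1 hp
    have h1 := le_d_pow ha hL hlam hN hi1 him (p := p + 1) (by omega) (by omega)
    have h2 := he (m - p) (by omega)
    rw [show m + 1 - (m - p) = p + 1 by omega] at h2
    rw [Nat.add_sub_add_right] at h1
    have h3 := c_nonneg i (m - p)
    calc _ ≤ c i (m - p) * (T ^ (m - p) *
          (L * lam (m - p) * (β a (p + 1) * noiseLevel m L a N) ^ (p + 1))) := by gcongr
      _ = T ^ (m - p) * L *
          (lam (m - p) * (β a (p + 1) * noiseLevel m L a N) ^ (p + 1) * c i (m - p)) := by ring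
      _ ≤ T ^ (m - p) * L * (c i (m + 1) * (q.choose (p + 1) : ℝ) * D ^ (p + 1)) := by gcongr
      _ = _ := by
        rw [show T ^ (m - p) = T ^ i * T ^ (q - (p + 1)) by rw [← pow_add]; congr 1; omega]
        ring
  · simp only [pow_zero, Nat.sub_zero, Nat.choose_zero_right, Nat.cast_one, one_mul, mul_one]
    rw [← hTq]
    ring

end Output

/-! ### Backward differences as reference trajectory. -/

section

variable {m : ℕ} {L T : ℝ} {lam : ℕ → ℝ} {N : ℝ} {g : ℕ → ℝ → ℝ}

/-- The scaled backward differences of `g`, which the state variables are meant to track. -/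
def refState (T : ℝ) (g : ℝ → ℝ) (k j : ℕ) : ℝ := (bdiff T)^[j] g (((k : ℝ) - 1) * T) / T ^ j

lemma refState_succ (hT : 0 < T) (g : ℝ → ℝ) (k j : ℕ) :
    refState T g (k + 1) j = refState T g k j + T * refState T g (k + 1) (j + 1) := by
  rw [refState, refState, refState, Function.iterate_succ_apply', bdiff, pow_succ]
  rw [show (((k + 1 : ℕ) : ℝ) - 1) * T - T = ((k : ℝ) - 1) * T by push_cast; ring]
  field_simp
  ring

/-- The estimation error along a solution. -/
def errorOf (T : ℝ) (g : ℝ → ℝ) (z : ℕ → Fin (m + 1) → ℝ) (k j : ℕ) : ℝ :=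
  refState T g k j - toSeq (z k) j

/-- The reference differences telescope exactly like the implicit chain, so subtracting the states
leaves only the corrections; the difference of order `m + 1` plays the role of the disturbance. -/
lemma DerivChain.exists_errorTraj (hg : DerivChain m L g) (hT : 0 < T) {η : ℕ → ℝ}
    (hη : ∀ k, |η k| ≤ N) {z₁ : Fin (m + 1) → ℝ} {u : ℕ → ℝ}
    (hu : ∀ k : ℕ, u k = g 0 (k * T) + η k) {z : ℕ → Fin (m + 1) → ℝ}
    (hz : IsSolution m L T lam z₁ u z) :
    ∃ s, ErrorTraj m L T lam N (errorOf T (g 0) z) (fun k => u k - toSeq (z (k + 1)) 0) η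
      (fun k => refState T (g 0) (k + 1) (m + 1)) s := by
  have hs : ∀ k, ∃ s, 1 ≤ k → s ∈ signSet (u k - toSeq (z (k + 1)) 0) ∧
      toSeq (z (k + 1)) m = toSeq (z k) m + T * lam (m + 1) * L * s := by
    intro k
    by_cases hk : 1 ≤ k
    · obtain ⟨s, hs⟩ := (mem_rhs_iff.1 (hz.2 k hk)).2
      exact ⟨s, fun _ => hs⟩
    · exact ⟨0, fun h => absurd h hk⟩
  choose s hs using hs
  refine ⟨s, fun k hk => ?_, fun k hk i hi => ?_, fun k hk => ?_, fun k hk => (hs k hk).1,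
    fun k _ => ?_, hη⟩
  · simp only [errorOf, refState, hu]
    simp
    ring
  · simp only [errorOf]
    rw [refState_succ hT, (mem_rhs_iff.1 (hz.2 k hk)).1 i hi]
    ring
  · simp only [errorOf]
    rw [refState_succ hT, (hs k hk).2]
    ring
  · simp only [refState]
    rw [abs_div, abs_of_pos (pow_pos hT _), div_le_iff₀ (pow_pos hT _)]
    exact hg.abs_iterate_bdiff_le hT.le _

lemma DerivChain.abs_output_sub_le (hg : DerivChain m L g) (hT : 0 < T)
    (z : ℕ → Fin (m + 1) → ℝ) {i : ℕ} (hi : i ≤ m) (k : ℕ) :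
    T ^ i * |output m T z i k - g i (k * T)| ≤ ∑ j ∈ Finset.range (m + 1),
      c i j * (T ^ j * |errorOf T (g 0) z (k + 1) j|) + c i (m + 1) * L * T ^ (m + 1) := by
  have h1 := hg.abs_sub_sum_le hT (k * T) i hi
  have h2 : T ^ i * (output m T z i k - g i (k * T)) =
      -(∑ j ∈ Finset.range (m + 1), c i j * (T ^ j * errorOf T (g 0) z (k + 1) j)) -
      (T ^ i * g i (k * T) -
        ∑ j ∈ Finset.range (m + 1), c i j * (IRED.bdiff T)^[j] (g 0) (k * T)) := by
    have h3 : ∀ j, T ^ j * errorOf T (g 0) z (k + 1) j =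
        (IRED.bdiff T)^[j] (g 0) (k * T) - T ^ j * toSeq (z (k + 1)) j := by
      intro j
      rw [errorOf, refState, mul_sub, mul_div_cancel₀ _ (pow_pos hT j).ne']
      push_cast
      rw [add_sub_cancel_right]
    simp only [h3, mul_sub, pow_mul_output, Finset.sum_sub_distrib]
    ring
  rw [← abs_of_pos (pow_pos hT i), ← abs_mul, h2]
  refine (abs_sub _ _).trans (add_le_add ?_ h1)
  rw [abs_neg]
  refine (Finset.abs_sum_le_sum_abs _ _).trans (le_of_eq (Finset.sum_congr rfl fun j _ => ?_))
  rw [abs_mul, abs_mul, abs_of_nonneg (c_nonneg i j), abs_of_pos (pow_pos hT j)]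

/-- At zero argument the sign is all of `[-1, 1]`; the selections 0 and 1 give different last
coordinates. -/
lemma inSlidingMode_of_eq (hL : 0 < L) (hT : 0 < T) (hlam1 : 0 < lam (m + 1)) {u : ℕ → ℝ}
    {z : ℕ → Fin (m + 1) → ℝ} {k : ℕ} (h : z (k + 1) 0 = u k) :
    InSlidingMode m L T lam u z k := by
  have hs : ∀ s ∈ Icc (-1 : ℝ) 1, s ∈ signSet (u k - z (k + 1) 0) := fun s hs => by
    rw [h, sub_self]
    exact ⟨fun h0 => absurd rfl h0, fun _ => hs⟩
  let w : ℝ → Fin (m + 1) → ℝ := fun s => Fin.lastCases (z k (Fin.last m) + T * lam (m + 1) * L * s)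
    fun i => z k i.castSucc + T * lam (i + 1) * L ^ (((i : ℝ) + 1) / ((m : ℝ) + 1))
      * spow (u k - z (k + 1) 0) (((m : ℝ) - i) / ((m : ℝ) + 1)) + T * z (k + 1) i.succ
  have hw : ∀ s ∈ Icc (-1 : ℝ) 1, w s ∈ rhs m L T lam (z k) (z (k + 1)) (u k) := fun s hs' =>
    ⟨fun i => by simp [w], s, hs s hs', by simp [w]⟩
  refine ⟨w 0, hw 0 (by simp), w 1, hw 1 (by simp), fun heq => ?_⟩
  have := congrFun heq (Fin.last m)
  simp only [w, Fin.lastCases_last, mul_zero, mul_one] at this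
  have : 0 < T * lam (m + 1) * L := by positivity
  linarith

end

end IRED

end

theorem theorem2 (m : ℕ) (hm : 1 ≤ m) (L T : ℝ) (hL : 0 < L) (hT : 0 < T)
    (a : ℕ → ℝ) (ha : ∀ j ∈ Finset.Icc 1 m, a j ∈ Set.Ioo (1 : ℝ) 2)
    (lam : ℕ → ℝ) (hlam0 : lam 0 = 1) (hlam : ∀ i ∈ Finset.Icc 1 (m + 1), 0 < lam i)
    (hlam1 : 1 < lam (m + 1))
    (hcond : ∀ j ∈ Finset.Icc 1 m,
      lam (m - j + 2) / lam (m - j + 1) * IRED.μ a j < lam (m - j + 1) / lam (m - j))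
    (z₁ : Fin (m + 1) → ℝ) (N : ℝ) (hN : 0 ≤ N) (v : Fin (m + 1) → ℝ) :
    ∃ K : ℕ, 1 ≤ K ∧
      ∀ f ∈ IRED.signals m L, (∀ i : Fin (m + 1), IRED.sigDeriv i f 0 = v i) →
      ∀ η ∈ IRED.noises N,
        (∃ z, IRED.IsSolution m L T lam z₁ (IRED.meas T f η) z) ∧
        ∀ z, IRED.IsSolution m L T lam z₁ (IRED.meas T f η) z →
          (∀ i ∈ Finset.Icc 1 m, ∀ k, K ≤ k →
            |IRED.output m T z i k - IRED.sigDeriv i f (k * T)| ≤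
              IRED.c i (m + 1) * L *
                (T + IRED.d m a lam i * (N / L) ^ (1 / ((m : ℝ) + 1))) ^ (m - i + 1)) ∧
          (N ≤ IRED.Nbar m L T a lam → ∀ k, K ≤ k →
            IRED.InSlidingMode m L T lam (IRED.meas T f η) z k ∧
              z (k + 1) 0 = IRED.meas T f η k) := by
  have hlam' : ∀ i ≤ m + 1, 0 < lam i := fun i hi => by
    rcases i.eq_zero_or_pos with rfl | h
    · rw [hlam0]; exact one_pos
    · exact hlam i (Finset.mem_Icc.2 ⟨h, hi⟩)
  obtain ⟨K, hK, hbound⟩ := IRED.exists_errorBound ha hL hT hlam0 hlam' hlam1 hcond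
    -- The initial error, written through `v` and `z₁` alone so that `K` is chosen before `f` and
    -- `η`.
    (fun j => (IRED.bdiff T)^[j] (IRED.taylorPoly m (IRED.toSeq v) 0) 0 / T ^ j
      - IRED.toSeq z₁ j) hN
  refine ⟨K, hK, fun f hf hv η hη =>
    ⟨IRED.exists_isSolution hL hT hlam' z₁ _, fun z hz => ?_⟩⟩
  have hv' : ∀ i ≤ m, IRED.sigDeriv i f 0 = IRED.toSeq v i := fun i hi => by
    rw [IRED.toSeq, dif_pos (Nat.lt_succ_of_le hi)]
    exact hv ⟨i, Nat.lt_succ_of_le hi⟩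
  have hg := IRED.derivChain_extension hL.le hf hv'
  have hext : ∀ i k : ℕ, IRED.extension m (IRED.toSeq v) f i (k * T) =
      IRED.sigDeriv i f (k * T) := fun i k => IRED.extension_of_nonneg _ _ _ _ (by positivity)
  obtain ⟨s, ht⟩ := hg.exists_errorTraj hT hη (fun k => by
    rw [hext, IRED.meas, IRED.sigDeriv, iteratedDerivWithin_zero]) hz
  have hb := hbound _ _ _ _ _ ht (by
    funext j
    rw [IRED.errorOf, IRED.refState, hz.1, Nat.cast_one, sub_self, zero_mul,
      IRED.iterate_bdiff_congr hT.le
        (fun t ht => IRED.extension_of_nonpos hv' (Nat.zero_le m) ht) j 0 le_rfl])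
  refine ⟨fun i hi k hk => ?_, fun hNbar k hk => ?_⟩
  · obtain ⟨hi1, him⟩ := Finset.mem_Icc.1 hi
    rw [← hext]
    exact le_of_mul_le_mul_left ((hg.abs_output_sub_le hT z him k).trans
      -- The output with index `k` uses the state at `k + 1`, whose reference differences are taken
      -- at time `k * T`.
      (IRED.sum_le_of_errorBound ha hL hT hlam' hN (hb (k + 1) (by omega)) hi1 him))
      (pow_pos hT i)
  · have hσ := ht.sliding ha hL hT hlam0 hlam' hlam1 hN hNbar (hK.trans hk) (hb k hk)
    have hz0 : z (k + 1) 0 = IRED.meas T f η k := by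
      rw [← IRED.toSeq_fin (z (k + 1)) 0]
      exact (sub_eq_zero.1 hσ).symm
    exact ⟨IRED.inSlidingMode_of_eq hL hT (hlam' (m + 1) le_rfl) hz0, hz0⟩
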